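/- Let $d\in\{2,3\}$, let $k\ge 1$ be an integer, let $\mathbf F:(0,1)^d\to\mathbb R^d$ be bi-Lipschitz onto its image $\Omega_0=\mathbf F((0,1)^d)$, and let $\theta\in(0,1]$ and $\sigma\in\mathbb R$. Then there is a constant $C>0$, depending only on $d,k,\mathbf F,\theta,\sigma$, such that the following holds. For $1\le\ell\le d$ let $\Xi_\ell$ be a $k$-open knot vector on $[0,1]$, that is, $0=\xi_{\ell,1}=\dots=\xi_{\ell,k+1}<\xi_{\ell,k+2}\le\dots\le\xi_{\ell,n_\ell}<\xi_{\ell,n_\ell+1}=\dots=\xi_{\ell,n_\ell+k+1}=1$, whose internal knots have multiplicity at most $k$. Let $\hat Q_h$ be the span of the tensor products $\hat B_{i_1,k}(x_1)\cdots\hat B_{i_d,k}(x_d)$, $1\le i_\ell\le n_\ell$, of the B-splines of degree $k$ of these knot vectors (Cox–de Boor formula). Let $\hat{\mathcal M}_{0,h}$ be the mesh of the open boxes $Q=I_1\times\dots\times I_d$, where $I_\ell$ is an open interval between two consecutive distinct knots of $\Xi_\ell$, and assume that $\operatorname{diam}(Q)\le\sigma\,|I_\ell|$ for all such $Q$ and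 all $\ell$ (shape regularity). Let $\Omega_1\subset\mathbb R^d$ be any set and $\Omega=\Omega_0\setminus\overline\Omega_1$ the trimmed domain. Define $$Q_h=\{q_h|_\Omega:\ q_h:\Omega_0\to\mathbb R,\ q_h\circ\mathbf F\in\hat Q_h|_{(0,1)^d}\},\qquad \mathcal M_h=\{K=\mathbf F(Q):\ Q\in\hat{\mathcal M}_{0,h},\ K\cap\Omega\neq\emptyset\},$$ $$\mathcal M_h^g=\{K\in\mathcal M_h:\ |K\cap\Omega|\ge\theta|K|\},\qquad S_h=\Omega\setminus\bigcup_{K\in\mathcal M_h^g}\overline K .$$ Then for every $q_h\in Q_h$ there exists $\tilde q_h\in Q_h$ such that $$\tilde q_h=q_h\ \text{ on }\ \Omega\setminus\overline S_h\qquad\text{and}\qquad \|\tilde q_h\|_{L^2(\Omega)}\le C\,\|q_h\|_{L^2(\Omega\setminus\overline S_h)} .$$ In particular, $C$ depends neither on the mesh size nor on the way $\Omega_1$ cuts the mesh. -/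

import Mathlib

open MeasureTheory

noncomputable section

/-- A `k`-open knot vector on `[0,1]` with `n + k + 1` knots, indexed from `0`:
`knot 0, …, knot (n + k)` (the values of `knot` at larger indices play no role).
Internal knots have multiplicity at most `k`, so that the splines are continuous. -/
structure OpenKnotVector (k : ℕ) where
  /-- the number of B-splines -/
  n : ℕ
  knot : ℕ → ℝ
  mono : ∀ i j, i ≤ j → j ≤ n + k → knot i ≤ knot j
  first_eq : ∀ i, i ≤ k → knot i = 0
  last_eq : ∀ i, n ≤ i → i ≤ n + k → knot i = 1
  first_lt : knot k < knot (k + 1)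
  lt_last : knot (n - 1) < knot n
  mult_le : ∀ t, 0 < t → t < 1 → Set.ncard {i | i ≤ n + k ∧ knot i = t} ≤ k

/-- The Cox–de Boor recursion; the B-spline of index `i` and degree `p` on the knots `ξ`.
The convention `0 / 0 = 0` of the recursion is the one of division in `ℝ`. -/
def bspline (ξ : ℕ → ℝ) : ℕ → ℕ → ℝ → ℝ
  | 0, i, x => Set.indicator (Set.Ico (ξ i) (ξ (i + 1))) (fun _ => 1) x
  | p + 1, i, x =>
      (x - ξ i) / (ξ (i + p + 1) - ξ i) * bspline ξ p i x +
      (ξ (i + p + 2) - x) / (ξ (i + p + 2) - ξ (i + 1)) * bspline ξ p (i + 1) x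

variable {d k : ℕ}

/-- The parametric domain `(0,1)^d`. -/
def paramCube (d : ℕ) : Set (EuclideanSpace ℝ (Fin d)) :=
  {x | ∀ l, x l ∈ Set.Ioo (0 : ℝ) 1}

/-- The tensor-product B-spline with multi-index `i`. -/
def tensorBSpline (Ξ : Fin d → OpenKnotVector k) (i : Fin d → ℕ) :
    EuclideanSpace ℝ (Fin d) → ℝ :=
  fun x => ∏ l, bspline (Ξ l).knot k (i l) (x l)

/-- The multivariate spline space of degree `k` in each direction: the span of the tensor-product
B-splines. Its elements are only ever evaluated in `(0,1)^d`. -/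
def splineSpace (Ξ : Fin d → OpenKnotVector k) :
    Submodule ℝ (EuclideanSpace ℝ (Fin d) → ℝ) :=
  Submodule.span ℝ {b | ∃ i : Fin d → ℕ, (∀ l, i l < (Ξ l).n) ∧ b = tensorBSpline Ξ i}

/-- `j` picks in each direction a nonempty knot span, that is, an interval between two consecutive
breakpoints. -/
def IsElementIndex (Ξ : Fin d → OpenKnotVector k) (j : Fin d → ℕ) : Prop :=
  ∀ l, j l < (Ξ l).n + k ∧ (Ξ l).knot (j l) < (Ξ l).knot (j l + 1)

/-- The open box which is the product of the knot spans `(ξ_{j_l}, ξ_{j_l + 1})`. -/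
def paramElement (Ξ : Fin d → OpenKnotVector k) (j : Fin d → ℕ) :
    Set (EuclideanSpace ℝ (Fin d)) :=
  {x | ∀ l, x l ∈ Set.Ioo ((Ξ l).knot (j l)) ((Ξ l).knot (j l + 1))}

/-- The parametric Bézier mesh. -/
def paramMesh (Ξ : Fin d → OpenKnotVector k) : Set (Set (EuclideanSpace ℝ (Fin d))) :=
  {Q | ∃ j, IsElementIndex Ξ j ∧ Q = paramElement Ξ j}

/-- Shape regularity with constant `σ`: the diameter of each element of the parametric mesh is at
most `σ` times each (hence the smallest) of its edges. -/
def IsShapeRegular (σ : ℝ) (Ξ : Fin d → OpenKnotVector k) : Prop :=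
  ∀ j, IsElementIndex Ξ j → ∀ l,
    Metric.diam (paramElement Ξ j) ≤ σ * ((Ξ l).knot (j l + 1) - (Ξ l).knot (j l))

/-- `F` is bi-Lipschitz on `s` (hence a bijection of `s` onto `F '' s`). -/
def IsBiLipschitzOn (F : EuclideanSpace ℝ (Fin d) → EuclideanSpace ℝ (Fin d))
    (s : Set (EuclideanSpace ℝ (Fin d))) : Prop :=
  ∃ L : ℝ, ∀ x ∈ s, ∀ y ∈ s,
    dist (F x) (F y) ≤ L * dist x y ∧ dist x y ≤ L * dist (F x) (F y)

/-- The trimmed domain `Ω = Ω₀ \ closure Ω₁` with `Ω₀ = F((0,1)^d)`. -/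
def trimmedDomain (F : EuclideanSpace ℝ (Fin d) → EuclideanSpace ℝ (Fin d))
    (Ω₁ : Set (EuclideanSpace ℝ (Fin d))) : Set (EuclideanSpace ℝ (Fin d)) :=
  (F '' paramCube d) \ closure Ω₁

/-- The active physical Bézier mesh: the images under `F` of the parametric elements that
meet `F⁻¹(Ω)`. -/
def activeMesh (F : EuclideanSpace ℝ (Fin d) → EuclideanSpace ℝ (Fin d))
    (Ξ : Fin d → OpenKnotVector k) (Ω : Set (EuclideanSpace ℝ (Fin d))) :
    Set (Set (EuclideanSpace ℝ (Fin d))) :=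
  {K | ∃ Q ∈ paramMesh Ξ, (Q ∩ F ⁻¹' Ω).Nonempty ∧ K = F '' Q}

/-- The good elements, those with `|K ∩ Ω| / |K| ≥ θ`. -/
def goodElements (F : EuclideanSpace ℝ (Fin d) → EuclideanSpace ℝ (Fin d))
    (Ξ : Fin d → OpenKnotVector k) (Ω : Set (EuclideanSpace ℝ (Fin d))) (θ : ℝ) :
    Set (Set (EuclideanSpace ℝ (Fin d))) :=
  {K | K ∈ activeMesh F Ξ Ω ∧ θ ≤ volume.real (K ∩ Ω) / volume.real K}

/-- The bad region `S_h`: the part of `Ω` outside the closures of the good elements. -/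
def badRegion (F : EuclideanSpace ℝ (Fin d) → EuclideanSpace ℝ (Fin d))
    (Ξ : Fin d → OpenKnotVector k) (Ω : Set (EuclideanSpace ℝ (Fin d))) (θ : ℝ) :
    Set (EuclideanSpace ℝ (Fin d)) :=
  Ω \ ⋃ K ∈ goodElements F Ξ Ω θ, closure K

/-- The untrimmed pressure space: the functions `q` on `Ω₀ = F((0,1)^d)` such that `q ∘ F` is a
spline on `(0,1)^d`. Values outside `Ω₀` are irrelevant. -/
def pressureSpace₀ (F : EuclideanSpace ℝ (Fin d) → EuclideanSpace ℝ (Fin d))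
    (Ξ : Fin d → OpenKnotVector k) : Set (EuclideanSpace ℝ (Fin d) → ℝ) :=
  {q | ∃ s ∈ splineSpace Ξ, Set.EqOn (q ∘ F) s (paramCube d)}

/-- The pressure space `Q_h` on `Ω`: the restrictions to `Ω` of the functions of the untrimmed
space. Values outside `Ω` are irrelevant. -/
def pressureSpace (F : EuclideanSpace ℝ (Fin d) → EuclideanSpace ℝ (Fin d))
    (Ξ : Fin d → OpenKnotVector k) (Ω : Set (EuclideanSpace ℝ (Fin d))) :
    Set (EuclideanSpace ℝ (Fin d) → ℝ) :=
  {q | ∃ q₀ ∈ pressureSpace₀ F Ξ, Set.EqOn q q₀ Ω}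

end

/-! Write `q ∘ F` as a B-spline sum with coefficients `c i`, keep `c i` when B-spline `i` is active
on some good element, and replace it by zero otherwise. The new spline, pushed forward by `F`, is
`q'`.

Agreement: a point of Ω outside the closure of the bad region lies in the closure of a good element.
There only the B-splines active on that element can be nonzero, and their coefficients were kept
(`exists_good_of_notMem_badRegion`, `splineOf_congr`). On the element boundary this uses the
continuity of the splines, that is, knot multiplicity at most `k`.

Stability: B-splines are bounded, so the integral of `q'` squared over any element is at most a
constant times `h ^ d` times the sum of the squared active coefficients (`exists_setLIntegral_le`).
Conversely, each kept coefficient is controlled by `q` on a good element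
(`exists_le_setLIntegral_of_good`). Since an element and an index are each related to at most `(k +
1) ^ d` of the other, summing costs only a constant (`sum_sum_activeIndices_le`).

The converse bound must not depend on the shape of the cut, so it is a sublevel set estimate: a
spline is small compared with its local coefficients only on a small fraction of the element
(`exists_volume_abs_sum_bspline_lt_le`), too small to fill the part kept by a good element. It
follows from Marsden's identity, which expresses monomials through B-splines with bounded
coefficients, and from compactness of the unit sphere of polynomial coefficients.

As `d ≥ 2`, shape regularity forces one mesh size `h` for all elements
(`IsShapeRegular.exists_meshSize`). -/

noncomputable section

/-! ### Univariate B-splines: support, bounds, Marsden's identity. -/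

theorem bspline_congr {ξ ξ' : ℕ → ℝ} {p i : ℕ}
    (h : ∀ m, i ≤ m → m ≤ i + p + 1 → ξ m = ξ' m) : bspline ξ p i = bspline ξ' p i := by
  induction p generalizing i with
  | zero =>
    funext x
    simp only [bspline, h i le_rfl (by omega), h (i + 1) (by omega) (by omega)]
  | succ p ih =>
    funext x
    simp only [bspline, ih (i := i) fun m h1 h2 => h m h1 (by omega),
      ih (i := i + 1) fun m h1 h2 => h m (by omega) (by omega),
      h i le_rfl (by omega), h (i + 1) (by omega) (by omega),
      h (i + p + 1) (by omega) (by omega), h (i + p + 2) (by omega) (by omega)]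

theorem bspline_eq_zero_of_lt {ξ : ℕ → ℝ} (hξ : Monotone ξ) {p i : ℕ} {x : ℝ} (h : x < ξ i) :
    bspline ξ p i x = 0 := by
  induction p generalizing i with
  | zero => simp [bspline, h]
  | succ p ih => simp [bspline, ih h, ih (h.trans_le (hξ (Nat.le_succ i)))]

theorem bspline_eq_zero_of_ge {ξ : ℕ → ℝ} (hξ : Monotone ξ) {p i : ℕ} {x : ℝ}
    (h : ξ (i + p + 1) ≤ x) : bspline ξ p i x = 0 := by
  induction p generalizing i with
  | zero => simp [bspline, (show ξ (i + 1) ≤ x from h)]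
  | succ p ih =>
    have h1 : ξ (i + p + 1) ≤ x := (hξ (by omega)).trans h
    have h2 : ξ (i + 1 + p + 1) ≤ x := (hξ (by omega)).trans h
    simp [bspline, ih h1, ih h2]

/-- Continuity at the left end of the support, where the half-open convention of degree `0` gives
nothing. The first term of the recursion carries the factor `x - ξ i = 0`; the second starts at a
later knot or falls under induction. -/
theorem bspline_left_eq_zero {ξ : ℕ → ℝ} (hξ : Monotone ξ) {p i : ℕ} (h : ξ i < ξ (i + p)) :
    bspline ξ p i (ξ i) = 0 := by
  induction p generalizing i with
  | zero => simp at h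
  | succ p ih =>
    have : bspline ξ p (i + 1) (ξ i) = 0 := by
      rcases (hξ (Nat.le_succ i)).lt_or_eq with h1 | h1
      · exact bspline_eq_zero_of_lt hξ h1
      · have e : ξ i = ξ (i + 1) := h1
        rw [e]
        apply ih
        rw [← e, show i + 1 + p = i + (p + 1) by ring]
        exact h
    simp [bspline, this]

/-- Both weights of the recursion lie in `[0,1]` on the supports, so each degree at most doubles the
bound. The sharp bound `1` is not needed. -/
theorem abs_bspline_le {ξ : ℕ → ℝ} (hξ : Monotone ξ) (p i : ℕ) (x : ℝ) :
    |bspline ξ p i x| ≤ 2 ^ p := by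
  induction p generalizing i with
  | zero =>
    simp only [bspline, pow_zero, Set.indicator]
    split_ifs <;> simp
  | succ p ih =>
    have h1 : |(x - ξ i) / (ξ (i + p + 1) - ξ i) * bspline ξ p i x| ≤ 2 ^ p := by
      rcases lt_or_ge x (ξ i) with h | h
      · simp [bspline_eq_zero_of_lt hξ h]
      rcases lt_or_ge x (ξ (i + p + 1)) with h' | h'
      · rw [abs_mul, abs_of_nonneg (div_nonneg (by linarith) (by linarith))]
        exact (mul_le_of_le_one_left (abs_nonneg _)
          (div_le_one_of_le₀ (by linarith) (by linarith))).trans (ih i)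
      · simp [bspline_eq_zero_of_ge hξ h']
    have h2 : |(ξ (i + p + 2) - x) / (ξ (i + p + 2) - ξ (i + 1)) * bspline ξ p (i + 1) x|
        ≤ 2 ^ p := by
      rcases lt_or_ge x (ξ (i + 1)) with h | h
      · simp [bspline_eq_zero_of_lt hξ h]
      rcases lt_or_ge x (ξ (i + p + 2)) with h' | h'
      · rw [abs_mul, abs_of_nonneg (div_nonneg (by linarith) (by linarith))]
        exact (mul_le_of_le_one_left (abs_nonneg _)
          (div_le_one_of_le₀ (by linarith) (by linarith))).trans (ih (i + 1))
      · rw [bspline_eq_zero_of_ge hξ (i := i + 1) (by rwa [show i + 1 + p + 1 = i + p + 2 by ring])]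
        simp
    rw [pow_succ, mul_two]
    exact (abs_add_le _ _).trans (add_le_add h1 h2)

theorem measurable_bspline (ξ : ℕ → ℝ) (p i : ℕ) : Measurable (bspline ξ p i) := by
  induction p generalizing i with
  | zero => exact measurable_const.indicator measurableSet_Ico
  | succ p ih =>
    have := ih i
    have := ih (i + 1)
    change Measurable fun x =>
      (x - ξ i) / (ξ (i + p + 1) - ξ i) * bspline ξ p i x +
      (ξ (i + p + 2) - x) / (ξ (i + p + 2) - ξ (i + 1)) * bspline ξ p (i + 1) x
    fun_prop

/-- Marsden's identity. -/
theorem sum_prod_mul_bspline {ξ : ℕ → ℝ} (hξ : Monotone ξ) {μ : ℕ} {x : ℝ} (hx : ξ μ ≤ x)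
    (hx' : x < ξ (μ + 1)) (y : ℝ) {p : ℕ} (hp : p ≤ μ) :
    ∑ j ∈ Finset.range (μ + 1), (∏ r ∈ Finset.range p, (y - ξ (j + 1 + r))) * bspline ξ p j x
      = (y - x) ^ p := by
  induction p with
  | zero =>
    rw [Finset.sum_range_succ, Finset.sum_eq_zero]
    · simp [bspline, hx, hx']
    · intro j hj
      rw [bspline_eq_zero_of_ge hξ ((hξ _).trans hx), mul_zero]
      have := Finset.mem_range.1 hj
      omega
  | succ p ih =>
    have hμ : bspline ξ p (μ + 1) x = 0 := bspline_eq_zero_of_lt hξ hx'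
    have h0 : bspline ξ p 0 x = 0 := bspline_eq_zero_of_ge hξ ((hξ (by omega)).trans hx)
    set f : ℕ → ℝ := fun j => (∏ r ∈ Finset.range (p + 1), (y - ξ (j + 1 + r))) *
      ((x - ξ j) / (ξ (j + p + 1) - ξ j) * bspline ξ p j x) with hf
    set g : ℕ → ℝ := fun j => (∏ r ∈ Finset.range (p + 1), (y - ξ (j + r))) *
      ((ξ (j + p + 1) - x) / (ξ (j + p + 1) - ξ j) * bspline ξ p j x) with hg
    have e1 : ∀ j, (∏ r ∈ Finset.range (p + 1), (y - ξ (j + 1 + r))) * bspline ξ (p + 1) j x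
        = f j + g (j + 1) := by
      intro j
      simp only [bspline, hf, hg, mul_add]
      rw [show j + 1 + p + 1 = j + p + 2 by ring]
    -- Shifting the index is free because both boundary B-splines vanish at `x`.
    have e2 : ∑ j ∈ Finset.range (μ + 1), g (j + 1) = ∑ j ∈ Finset.range (μ + 1), g j := by
      have a := Finset.sum_range_succ g (μ + 1)
      have b := Finset.sum_range_succ' g (μ + 1)
      have c : g 0 = 0 := by simp [hg, h0]
      have d : g (μ + 1) = 0 := by simp [hg, hμ]
      linarith
    simp only [e1]
    rw [Finset.sum_add_distrib, e2, ← Finset.sum_add_distrib, pow_succ, ← ih (by omega),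
      Finset.sum_mul]
    refine Finset.sum_congr rfl fun j hj => ?_
    have hj := Finset.mem_range.1 hj
    -- Either the support contains the span of `x`, so the denominator is positive and `(y -
    -- ξ_{j+p+1})(x - ξ_j) + (y - ξ_j)(ξ_{j+p+1} - x) = (y - x)(ξ_{j+p+1} - ξ_j)` applies, or it
    -- lies to the left of `x`.
    by_cases hjp : μ ≤ j + p
    · have hd : ξ (j + p + 1) - ξ j ≠ 0 := by
        have h1 : ξ j ≤ ξ μ := hξ (by omega)
        have h2 : ξ (μ + 1) ≤ ξ (j + p + 1) := hξ (by omega)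
        have : 0 < ξ (j + p + 1) - ξ j := by linarith
        exact this.ne'
      simp only [hf, hg]
      rw [Finset.prod_range_succ, Finset.prod_range_succ']
      have e3 : ∏ r ∈ Finset.range p, (y - ξ (j + (r + 1)))
          = ∏ r ∈ Finset.range p, (y - ξ (j + 1 + r)) :=
        Finset.prod_congr rfl fun r _ => by rw [show j + (r + 1) = j + 1 + r by ring]
      rw [e3, add_zero, show j + 1 + p = j + p + 1 by ring]
      field_simp
      ring
    · have : bspline ξ p j x = 0 := bspline_eq_zero_of_ge hξ ((hξ (by omega)).trans hx)
      simp [hf, hg, this]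

/-! ### Monomials in terms of B-splines on one knot span. -/

theorem Polynomial.abs_coeff_prod_X_sub_C_le {τ : ℕ → ℝ} {R : ℝ} (p : ℕ)
    (h : ∀ r < p, |τ r| ≤ R) (i : ℕ) :
    |(∏ r ∈ Finset.range p, (Polynomial.X - Polynomial.C (τ r))).coeff i| ≤ (1 + R) ^ p := by
  induction p generalizing i with
  | zero =>
    simp only [Finset.range_zero, Finset.prod_empty, Polynomial.coeff_one, pow_zero]
    split_ifs <;> simp
  | succ p ih =>
    have hR := h p (Nat.lt_succ_self p)
    have ih := ih fun r hr => h r (hr.trans (Nat.lt_succ_self p))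
    set q := ∏ r ∈ Finset.range p, (Polynomial.X - Polynomial.C (τ r))
    have key : ∀ i, |q.coeff i * τ p| ≤ (1 + R) ^ p * R := fun i => by
      rw [abs_mul]
      exact mul_le_mul (ih i) hR (abs_nonneg _) ((abs_nonneg _).trans (ih i))
    rw [Finset.prod_range_succ, pow_succ, mul_add, mul_one]
    cases i with
    | zero =>
      have h0 := ih 0
      have := (abs_nonneg _).trans h0
      have := key 0
      simp only [Polynomial.mul_coeff_zero, Polynomial.coeff_sub, Polynomial.coeff_X_zero,
        Polynomial.coeff_C_zero, zero_sub, mul_neg, abs_neg]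
      linarith
    | succ i =>
      rw [Polynomial.coeff_mul_X_sub_C]
      exact (abs_sub _ _).trans (add_le_add (ih i) (key (i + 1)))

theorem finite_setOf_sum_mul_pow_eq_zero {k : ℕ} {u : Fin (k + 1) → ℝ} (hu : u ≠ 0) :
    {x : ℝ | ∑ r, u r * x ^ (r : ℕ) = 0}.Finite := by
  by_contra h
  refine hu ?_
  have hP : (∑ r : Fin (k + 1), Polynomial.C (u r) * Polynomial.X ^ (r : ℕ)) = 0 := by
    refine Polynomial.eq_zero_of_infinite_isRoot _ (Set.Infinite.mono ?_ h)
    intro x hx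
    simpa [Polynomial.IsRoot, Polynomial.eval_finsetSum] using hx
  funext m
  have := congrArg (fun P => Polynomial.coeff P (m : ℕ)) hP
  simp only [Polynomial.finsetSum_coeff, Polynomial.coeff_C_mul_X_pow,
    Polynomial.coeff_zero, Fin.val_inj] at this
  simpa using this

/-- On a nonempty knot span, the scaled monomials are combinations of the active B-splines, with a
matrix of coefficients which is invertible and bounded in terms of the relative position of the
knots only. -/
theorem exists_matrix_monomial_eq_sum_bspline (k : ℕ) (R : ℝ) :
    ∃ C : ℝ, 0 < C ∧ ∀ ξ : ℕ → ℝ, Monotone ξ → ∀ (μ : ℕ) (h : ℝ), k ≤ μ → 0 < h →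
      ξ μ < ξ (μ + 1) → (∀ i, μ ≤ i + k → i ≤ μ + k → |ξ i - ξ μ| ≤ R * h) →
      ∃ A : Matrix (Fin (k + 1)) (Fin (k + 1)) ℝ, IsUnit A ∧ (∀ m a, |A m a| ≤ C) ∧
        ∀ x, ξ μ ≤ x → x < ξ (μ + 1) → ∀ m : Fin (k + 1),
          ((x - ξ μ) / h) ^ (m : ℕ) = ∑ a, A m a * bspline ξ k (μ - k + a) x := by
  refine ⟨(1 + |R|) ^ k, by positivity, fun ξ hξ μ h hk hh hμ hR => ?_⟩
  set q : Fin (k + 1) → Polynomial ℝ := fun a => ∏ r ∈ Finset.range k,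
    (Polynomial.X - Polynomial.C ((ξ (μ - k + a + 1 + r) - ξ μ) / h)) with hq
  -- Marsden's identity at `ξ μ + h * y`, divided by `h ^ k` and read as an identity of polynomials
  -- in `y`. Only the last `k + 1` B-splines survive.
  have marsden : ∀ x, ξ μ ≤ x → x < ξ (μ + 1) →
      ∑ a : Fin (k + 1), Polynomial.C (bspline ξ k (μ - k + a) x) * q a
        = (Polynomial.X + Polynomial.C (-((x - ξ μ) / h))) ^ k := by
    intro x hx hx'
    refine Polynomial.funext fun y => ?_
    have e := sum_prod_mul_bspline hξ hx hx' (ξ μ + h * y) hk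
    rw [show μ + 1 = (μ - k) + (k + 1) by omega, Finset.sum_range_add, Finset.sum_eq_zero,
      zero_add, Finset.sum_range] at e
    · have e4 : ξ μ + h * y - x = h * (y + -((x - ξ μ) / h)) := by field_simp; ring
      rw [e4, mul_pow] at e
      have hk0 : h ^ k ≠ 0 := (pow_pos hh k).ne'
      apply mul_left_cancel₀ hk0
      simp only [Polynomial.eval_pow, Polynomial.eval_add, Polynomial.eval_X, Polynomial.eval_C]
      rw [← e, Polynomial.eval_finsetSum, Finset.mul_sum]
      refine Finset.sum_congr rfl fun a _ => ?_
      simp only [hq, Polynomial.eval_mul, Polynomial.eval_C, Polynomial.eval_prod,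
        Polynomial.eval_sub, Polynomial.eval_X]
      have : h ^ k = ∏ r ∈ Finset.range k, h := by simp
      rw [mul_left_comm, this, ← Finset.prod_mul_distrib, mul_comm]
      congr 1
      refine Finset.prod_congr rfl fun r _ => ?_
      field_simp
      ring
    · intro j hj
      have := Finset.mem_range.1 hj
      rw [bspline_eq_zero_of_ge hξ ((hξ (by omega)).trans hx), mul_zero]
  -- The coefficient of `X ^ (k - m)` in `(X - t) ^ k` is `(-1) ^ m * (k.choose m) * t ^ m`; solve
  -- for `t ^ m`.
  set A : Matrix (Fin (k + 1)) (Fin (k + 1)) ℝ := fun m a =>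
    ((-1) ^ (m : ℕ) / (k.choose m : ℝ)) * (q a).coeff (k - m) with hA
  have mono : ∀ x, ξ μ ≤ x → x < ξ (μ + 1) → ∀ m : Fin (k + 1),
      ((x - ξ μ) / h) ^ (m : ℕ) = ∑ a, A m a * bspline ξ k (μ - k + a) x := by
    intro x hx hx' m
    have e := congrArg (fun P => Polynomial.coeff P (k - m)) (marsden x hx hx')
    simp only [Polynomial.finsetSum_coeff, Polynomial.coeff_C_mul,
      Polynomial.coeff_X_add_C_pow] at e
    have hm : (m : ℕ) ≤ k := Nat.lt_succ_iff.1 m.2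
    have hc : (k.choose m : ℝ) ≠ 0 := by exact_mod_cast (Nat.choose_pos hm).ne'
    rw [Nat.choose_symm hm, show k - (k - (m : ℕ)) = m by omega] at e
    simp only [hA, mul_assoc]
    rw [← Finset.mul_sum]
    simp only [mul_comm _ (bspline _ _ _ _)]
    rw [e, neg_pow ((x - ξ μ) / h)]
    have : ((-1 : ℝ) ^ (m : ℕ)) * (-1) ^ (m : ℕ) = 1 := by rw [← mul_pow]; simp
    field_simp
    rw [sq, this, mul_one]
  refine ⟨A, ?_, ?_, mono⟩
  -- A row vector killed by `A` would be the coefficients of a polynomial vanishing on a whole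
  -- interval.
  · rw [← Matrix.vecMul_injective_iff_isUnit]
    intro w₁ w₂ hw
    have hu : Matrix.vecMul (w₁ - w₂) A = 0 := by
      rw [Matrix.sub_vecMul, sub_eq_zero]
      exact hw
    set u := w₁ - w₂ with hu'
    rw [← sub_eq_zero]
    by_contra hu0
    refine (((Set.Ico_infinite hμ).image (f := fun x => (x - ξ μ) / h) ?_).mono ?_)
      (finite_setOf_sum_mul_pow_eq_zero (u := u) hu0)
    · intro x _ y _ hxy
      have : (x - ξ μ) / h = (y - ξ μ) / h := hxy
      field_simp at this
      linarith
    · rintro _ ⟨x, hx, rfl⟩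
      simp only [Set.mem_ofPred_eq, mono x hx.1 hx.2, Finset.mul_sum]
      rw [Finset.sum_comm]
      refine Finset.sum_eq_zero fun a _ => ?_
      have := congrFun hu a
      simp only [Matrix.vecMul, dotProduct, Pi.zero_apply] at this
      simp only [← mul_assoc]
      rw [← Finset.sum_mul, this, zero_mul]
  · intro m a
    have hm : (m : ℕ) ≤ k := Nat.lt_succ_iff.1 m.2
    have hc : (1 : ℝ) ≤ k.choose m := by exact_mod_cast Nat.choose_pos hm
    have hb : |(q a).coeff (k - m)| ≤ (1 + |R|) ^ k := by
      refine Polynomial.abs_coeff_prod_X_sub_C_le k (fun r hr => ?_) _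
      rw [abs_div, abs_of_pos hh, div_le_iff₀ hh]
      refine (hR _ (by omega) (by omega)).trans ?_
      exact mul_le_mul_of_nonneg_right (le_abs_self R) hh.le
    simp only [hA]
    rw [abs_mul, abs_div, abs_pow, abs_neg, abs_one, one_pow, abs_of_nonneg (by linarith)]
    refine (mul_le_of_le_one_left (abs_nonneg _) ?_).trans hb
    exact div_le_one_of_le₀ hc (by linarith)

/-! ### Sublevel sets of tensor-product polynomials. -/

/-- The polynomial of degree at most `k` in each variable with coefficients `w`. -/
def tensorPoly {d k : ℕ} (w : (Fin d → Fin (k + 1)) → ℝ) (x : Fin d → ℝ) : ℝ :=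
  ∑ m, w m * ∏ l, x l ^ (m l : ℕ)

theorem continuous_tensorPoly {d k : ℕ} (w : (Fin d → Fin (k + 1)) → ℝ) :
    Continuous (tensorPoly w) := by
  unfold tensorPoly
  fun_prop

theorem tensorPoly_cons {d k : ℕ} (w : (Fin (d + 1) → Fin (k + 1)) → ℝ) (x : ℝ)
    (y : Fin d → ℝ) :
    tensorPoly w (Fin.cons x y : Fin (d + 1) → ℝ) =
      tensorPoly (fun m => ∑ r : Fin (k + 1), w (Fin.cons r m : Fin (d + 1) → Fin (k + 1)) *
        x ^ (r : ℕ)) y := by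
  unfold tensorPoly
  rw [← (Fin.consEquiv fun _ : Fin (d + 1) => Fin (k + 1)).sum_comp, Fintype.sum_prod_type,
    Finset.sum_comm]
  refine Finset.sum_congr rfl fun m _ => ?_
  rw [Finset.sum_mul]
  refine Finset.sum_congr rfl fun r _ => ?_
  change w (Fin.cons r m) * _ = _
  simp only [Fin.consEquiv_apply, Fin.prod_univ_succ, Fin.cons_zero, Fin.cons_succ]
  ring

/-- Induction with Fubini: fixing the first variable leaves a nonzero polynomial in the others,
except for finitely many values. -/
theorem volume_tensorPoly_eq_zero {d k : ℕ} {w : (Fin d → Fin (k + 1)) → ℝ} (hw : w ≠ 0) :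
    volume {x | tensorPoly w x = 0} = 0 := by
  induction d with
  | zero =>
    obtain ⟨m, hm⟩ := Function.ne_iff.1 hw
    have : {x : Fin 0 → ℝ | tensorPoly w x = 0} = ∅ := by
      ext x
      have e : tensorPoly w x = w m := by
        rw [tensorPoly, Finset.sum_eq_single m (fun m' _ h => (h (Subsingleton.elim _ _)).elim)
          (fun h => (h (Finset.mem_univ _)).elim)]
        simp
      rw [Set.mem_ofPred_eq, e]
      exact iff_of_false hm (Set.notMem_empty _)
    simp [this]
  | succ d ih =>
    have hm : MeasurableSet {x | tensorPoly w x = 0} :=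
      (continuous_tensorPoly w).measurable (measurableSet_singleton 0)
    have hp := (volume_preserving_piFinSuccAbove (fun _ : Fin (d + 1) => ℝ) 0).symm
    rw [← hp.measure_preimage hm.nullMeasurableSet]
    refine (Measure.measure_prod_null (hp.measurable hm)).2 ?_
    obtain ⟨m, hm⟩ := Function.ne_iff.1 hw
    have hfin := finite_setOf_sum_mul_pow_eq_zero
      (u := fun r => w (Fin.cons r (Fin.tail m) : Fin (d + 1) → Fin (k + 1))) (by
        refine Function.ne_iff.2 ⟨m 0, ?_⟩
        simpa using hm)
    filter_upwards [(hfin.measure_zero volume : _)|> measure_eq_zero_iff_ae_notMem.1] with x hx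
    have := ih (w := fun m => ∑ r : Fin (k + 1), w (Fin.cons r m : Fin (d + 1) → Fin (k + 1)) *
        x ^ (r : ℕ)) (Function.ne_iff.2 ⟨Fin.tail m, hx⟩)
    simp only [← tensorPoly_cons] at this
    simpa [MeasurableEquiv.piFinSuccAbove, Set.preimage, Fin.insertNthEquiv] using this

/-- For fixed `w ≠ 0` the sublevel sets shrink to the null zero set. Lipschitz dependence on `w`
makes `ε` locally uniform, compactness of the unit sphere makes it uniform there, and homogeneity
does the rest. -/
theorem exists_volume_abs_tensorPoly_lt_le (d k : ℕ) (R : ℝ) {δ : ENNReal} (hδ : δ ≠ 0) :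
    ∃ ε : ℝ, 0 < ε ∧ ∀ w : (Fin d → Fin (k + 1)) → ℝ,
      volume {x : Fin d → ℝ | (∀ l, |x l| ≤ R) ∧ |tensorPoly w x| < ε * ‖w‖} ≤ δ := by
  set B : Set (Fin d → ℝ) := {x | ∀ l, |x l| ≤ R} with hB
  have hBc : IsCompact B := by
    have : B = Set.univ.pi fun _ => Set.Icc (-R) R := by
      ext x
      simp only [hB, abs_le, Set.mem_ofPred_eq, Set.mem_univ_pi, Set.mem_Icc]
    rw [this]
    exact isCompact_univ_pi fun _ => isCompact_Icc
  have hdiff : ∃ C : ℝ, 0 < C ∧ ∀ (w w' : (Fin d → Fin (k + 1)) → ℝ), ∀ x ∈ B,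
      |tensorPoly w x - tensorPoly w' x| ≤ C * ‖w - w'‖ := by
    have hf : Continuous fun x : Fin d → ℝ => ∑ m : Fin d → Fin (k + 1), |∏ l, x l ^ (m l : ℕ)| := by
      fun_prop
    obtain ⟨C, hC⟩ := hBc.bddAbove_image hf.continuousOn
    refine ⟨max C 1, by positivity, fun w w' x hx => ?_⟩
    unfold tensorPoly
    rw [← Finset.sum_sub_distrib]
    simp only [← sub_mul]
    refine (Finset.abs_sum_le_sum_abs _ _).trans ?_
    refine le_trans (b := ∑ m : Fin d → Fin (k + 1), ‖w - w'‖ * |∏ l, x l ^ (m l : ℕ)|) ?_ ?_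
    · refine Finset.sum_le_sum fun m _ => ?_
      rw [abs_mul]
      exact mul_le_mul_of_nonneg_right (norm_le_pi_norm (w - w') m) (abs_nonneg _)
    · rw [← Finset.mul_sum, mul_comm]
      exact mul_le_mul_of_nonneg_right
        ((hC (Set.mem_image_of_mem _ hx)).trans (le_max_left _ _)) (norm_nonneg _)
  obtain ⟨C, hC, hdiff⟩ := hdiff
  have main : ∃ ε : ℝ, 0 < ε ∧ ∀ w ∈ Metric.sphere (0 : (Fin d → Fin (k + 1)) → ℝ) 1,
      volume {x | x ∈ B ∧ |tensorPoly w x| < ε} ≤ δ := by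
    refine (isCompact_sphere (0 : (Fin d → Fin (k + 1)) → ℝ) 1).induction_on
      (p := fun S => ∃ ε : ℝ, 0 < ε ∧ ∀ w ∈ S, volume {x | x ∈ B ∧ |tensorPoly w x| < ε} ≤ δ)
      ⟨1, one_pos, by simp⟩ ?_ ?_ ?_
    · rintro s t hst ⟨ε, hε, h⟩
      exact ⟨ε, hε, fun w hw => h w (hst hw)⟩
    · rintro s t ⟨ε, hε, h⟩ ⟨ε', hε', h'⟩
      refine ⟨min ε ε', lt_min hε hε', ?_⟩
      rintro w (hw | hw)
      · refine (measure_mono ?_).trans (h w hw)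
        exact fun x hx => ⟨hx.1, hx.2.trans_le (min_le_left _ _)⟩
      · refine (measure_mono ?_).trans (h' w hw)
        exact fun x hx => ⟨hx.1, hx.2.trans_le (min_le_right _ _)⟩
    · intro w hw
      have hw0 : w ≠ 0 := by
        rintro rfl
        simp at hw
      have htend := tendsto_measure_biInter_gt (μ := (volume : Measure (Fin d → ℝ))) (a := (0 : ℝ))
        (s := fun r => {x | x ∈ B ∧ |tensorPoly w x| < r})
        (fun r _ => (hBc.measurableSet.inter ((continuous_tensorPoly w).abs.measurable
          measurableSet_Iio)).nullMeasurableSet)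
        (fun i j _ hij x hx => ⟨hx.1, hx.2.trans_le hij⟩)
        ⟨1, one_pos, ((measure_mono fun x hx => hx.1).trans_lt hBc.measure_lt_top).ne⟩
      have hzero : volume (⋂ r, ⋂ (_ : r > (0 : ℝ)), {x | x ∈ B ∧ |tensorPoly w x| < r}) = 0 := by
        refine measure_mono_null ?_ (volume_tensorPoly_eq_zero hw0)
        intro x hx
        simp only [Set.mem_iInter] at hx
        refine abs_eq_zero.1 (le_antisymm ?_ (abs_nonneg _))
        exact le_of_forall_pos_le_add fun r hr => by simpa using (hx r hr).2.le
      rw [hzero] at htend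
      obtain ⟨r, hr, hr0⟩ := ((htend.eventually_le_const (pos_iff_ne_zero.2 hδ)).and
        self_mem_nhdsWithin).exists
      have hr0 : 0 < r := hr0
      -- In this ball the values on `B` move by less than `r / 2`, so a value below `r / 2` for `w'`
      -- is below `r` for `w`.
      refine ⟨Metric.ball w (r / (2 * C)), mem_nhdsWithin_of_mem_nhds
        (Metric.ball_mem_nhds _ (by positivity)), r / 2, by positivity, fun w' hw' => ?_⟩
      refine (measure_mono ?_).trans hr
      rintro x ⟨hx, hx'⟩
      refine ⟨hx, ?_⟩
      have h1 := hdiff w w' x hx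
      have h2 : C * ‖w - w'‖ < r / 2 := by
        rw [Metric.mem_ball, dist_comm, dist_eq_norm, lt_div_iff₀ (by positivity)] at hw'
        linarith
      have h3 : |tensorPoly w x| ≤ |tensorPoly w x - tensorPoly w' x| + |tensorPoly w' x| := by
        simpa using abs_add_le (tensorPoly w x - tensorPoly w' x) (tensorPoly w' x)
      have hx'' : |tensorPoly w' x| < r / 2 := hx'
      change |tensorPoly w x| < r
      linarith
  obtain ⟨ε, hε, main⟩ := main
  refine ⟨ε, hε, fun w => ?_⟩
  by_cases hw : w = 0
  · simp [hw, (abs_nonneg _).not_gt]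
  have hn : 0 < ‖w‖ := norm_pos_iff.2 hw
  refine (measure_mono ?_).trans (main (‖w‖⁻¹ • w) ?_)
  · rintro x ⟨hx, hx'⟩
    refine ⟨hx, ?_⟩
    have : tensorPoly (‖w‖⁻¹ • w) x = ‖w‖⁻¹ * tensorPoly w x := by
      simp [tensorPoly, Finset.mul_sum, mul_assoc]
    rw [this, abs_mul, abs_of_pos (inv_pos.2 hn), inv_mul_lt_iff₀ hn, mul_comm]
    exact hx'
  · simp [norm_smul, hn.ne']

/-! ### Bi-Lipschitz maps and volume. -/

/-- Lebesgue measure is a multiple of the `d`-dimensional Hausdorff measure, for which the bound is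
standard. -/
theorem LipschitzOnWith.volume_image_le {d : ℕ} {K : NNReal}
    {f : EuclideanSpace ℝ (Fin d) → EuclideanSpace ℝ (Fin d)} {s : Set (EuclideanSpace ℝ (Fin d))}
    (hf : LipschitzOnWith K f s) : volume (f '' s) ≤ (K : ENNReal) ^ d * volume s := by
  set ν : Measure (EuclideanSpace ℝ (Fin d)) :=
    μH[(Module.finrank ℝ (EuclideanSpace ℝ (Fin d)) : ℝ)] with hν
  have e : (volume : Measure (EuclideanSpace ℝ (Fin d))) =
      Measure.addHaarScalarFactor volume ν • ν := Measure.isAddLeftInvariant_eq_smul _ _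
  have h := hf.hausdorffMeasure_image_le
    (d := (Module.finrank ℝ (EuclideanSpace ℝ (Fin d)) : ℝ)) (Nat.cast_nonneg _)
  rw [← hν, ENNReal.rpow_natCast, finrank_euclideanSpace_fin] at h
  rw [e]
  simp only [Measure.smul_apply]
  rw [mul_smul_comm]
  gcongr

theorem IsBiLipschitzOn.exists_dist_le {d : ℕ}
    {F : EuclideanSpace ℝ (Fin d) → EuclideanSpace ℝ (Fin d)} {s : Set (EuclideanSpace ℝ (Fin d))}
    (hF : IsBiLipschitzOn F s) : ∃ K : NNReal, 0 < K ∧ LipschitzOnWith K F s ∧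
      ∀ x ∈ s, ∀ y ∈ s, dist x y ≤ K * dist (F x) (F y) := by
  obtain ⟨L, hL⟩ := hF
  have hK : L ≤ ((L.toNNReal ⊔ 1 : NNReal) : ℝ) := by simp
  refine ⟨L.toNNReal ⊔ 1, by positivity, LipschitzOnWith.of_dist_le_mul fun x hx y hy => ?_,
    fun x hx y hy => ?_⟩
  · exact (hL x hx y hy).1.trans (mul_le_mul_of_nonneg_right hK dist_nonneg)
  · exact (hL x hx y hy).2.trans (mul_le_mul_of_nonneg_right hK dist_nonneg)

theorem IsBiLipschitzOn.injOn {d : ℕ}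
    {F : EuclideanSpace ℝ (Fin d) → EuclideanSpace ℝ (Fin d)} {s : Set (EuclideanSpace ℝ (Fin d))}
    (hF : IsBiLipschitzOn F s) : Set.InjOn F s := by
  obtain ⟨K, -, -, hK⟩ := hF.exists_dist_le
  intro x hx y hy hxy
  have := hK x hx y hy
  rw [hxy, dist_self, mul_zero] at this
  exact dist_le_zero.1 this

theorem IsBiLipschitzOn.continuousOn {d : ℕ}
    {F : EuclideanSpace ℝ (Fin d) → EuclideanSpace ℝ (Fin d)} {s : Set (EuclideanSpace ℝ (Fin d))}
    (hF : IsBiLipschitzOn F s) : ContinuousOn F s := by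
  obtain ⟨K, -, hK, -⟩ := hF.exists_dist_le
  exact hK.continuousOn

theorem IsBiLipschitzOn.measurableSet_image {d : ℕ}
    {F : EuclideanSpace ℝ (Fin d) → EuclideanSpace ℝ (Fin d)}
    {s t : Set (EuclideanSpace ℝ (Fin d))} (hF : IsBiLipschitzOn F s) (ht : MeasurableSet t)
    (hts : t ⊆ s) : MeasurableSet (F '' t) :=
  ht.image_of_continuousOn_injOn (hF.continuousOn.mono hts) (hF.injOn.mono hts)

theorem IsBiLipschitzOn.exists_volume_image_le {d : ℕ}
    {F : EuclideanSpace ℝ (Fin d) → EuclideanSpace ℝ (Fin d)} {s : Set (EuclideanSpace ℝ (Fin d))}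
    (hF : IsBiLipschitzOn F s) : ∃ c : NNReal, 0 < c ∧ ∀ A ⊆ s,
      volume (F '' A) ≤ c * volume A ∧ volume A ≤ c * volume (F '' A) := by
  obtain ⟨K, hK, hl, hd⟩ := hF.exists_dist_le
  refine ⟨K ^ d, by positivity, fun A hA => ⟨?_, ?_⟩⟩
  · simpa using (hl.mono hA).volume_image_le
  · rcases A.eq_empty_or_nonempty with rfl | hne
    · simp
    have hinj := hF.injOn.mono hA
    have hG : LipschitzOnWith K (Function.invFunOn F A) (F '' A) := by
      refine LipschitzOnWith.of_dist_le_mul ?_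
      rintro _ ⟨x, hx, rfl⟩ _ ⟨y, hy, rfl⟩
      rw [hinj.leftInvOn_invFunOn hx, hinj.leftInvOn_invFunOn hy]
      exact hd x (hA hx) y (hA hy)
    have := hG.volume_image_le
    rw [hinj.leftInvOn_invFunOn.image_image] at this
    simpa using this

/-- Continuity of the inverse on the image. It stands in for openness of `F`, so that invariance of
domain is never used. -/
theorem IsBiLipschitzOn.tendsto_of_tendsto_image {d : ℕ}
    {F : EuclideanSpace ℝ (Fin d) → EuclideanSpace ℝ (Fin d)} {s : Set (EuclideanSpace ℝ (Fin d))}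
    (hF : IsBiLipschitzOn F s) {u : ℕ → EuclideanSpace ℝ (Fin d)} {y : EuclideanSpace ℝ (Fin d)}
    (hu : ∀ n, u n ∈ s) (hy : y ∈ s)
    (h : Filter.Tendsto (fun n => F (u n)) Filter.atTop (nhds (F y))) :
    Filter.Tendsto u Filter.atTop (nhds y) := by
  obtain ⟨K, -, -, hd⟩ := hF.exists_dist_le
  rw [tendsto_iff_dist_tendsto_zero] at h ⊢
  refine squeeze_zero (fun _ => dist_nonneg) (fun n => hd _ (hu n) _ hy) ?_
  simpa using h.const_mul (K : ℝ)

/-! ### Local stability of the tensor-product B-spline basis. -/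

theorem abs_sub_le_of_forall_sub_le {ξ : ℕ → ℝ} (hξ : Monotone ξ) {g : ℝ}
    (hg : ∀ i, ξ (i + 1) - ξ i ≤ g) {i μ k : ℕ} (h1 : μ ≤ i + k) (h2 : i ≤ μ + k) :
    |ξ i - ξ μ| ≤ k * g := by
  have hg0 : 0 ≤ g := (sub_nonneg.2 (hξ (Nat.le_succ 0))).trans (hg 0)
  have key : ∀ n j, ξ (j + n) - ξ j ≤ n * g := by
    intro n j
    induction n with
    | zero => simp
    | succ n ih =>
      have := hg (j + n)
      push_cast
      rw [← add_assoc]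
      linarith
  have key' : ∀ a b, a ≤ b → b ≤ a + k → ξ b - ξ a ≤ k * g := by
    intro a b hab hb
    obtain ⟨n, rfl⟩ := Nat.exists_eq_add_of_le hab
    have hn : (n : ℝ) ≤ k := by exact_mod_cast (by omega : n ≤ k)
    exact (key n a).trans (mul_le_mul_of_nonneg_right hn hg0)
  rcases le_total i μ with h | h
  · rw [abs_sub_comm, abs_of_nonneg (sub_nonneg.2 (hξ h))]
    exact key' _ _ h h1
  · rw [abs_of_nonneg (sub_nonneg.2 (hξ h))]
    exact key' _ _ h h2

theorem volume_setOf_scaled_mem {d : ℕ} (b : Fin d → ℝ) {h : ℝ} (hh : 0 < h)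
    (S : Set (Fin d → ℝ)) :
    volume {x : EuclideanSpace ℝ (Fin d) | (fun l => (x l - b l) / h) ∈ S}
      = ENNReal.ofReal (h ^ d) * volume S := by
  have e1 : {x : EuclideanSpace ℝ (Fin d) | (fun l => (x l - b l) / h) ∈ S} =
      (MeasurableEquiv.toLp 2 (Fin d → ℝ)).symm ⁻¹'
        ((fun y => y - b) ⁻¹' ((fun y => h⁻¹ • y) ⁻¹' S)) := by
    ext x
    simp only [Set.mem_ofPred_eq, Set.mem_preimage]
    have : (fun l => (x l - b l) / h) = h⁻¹ • (x.ofLp - b) := by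
      funext l
      simp [div_eq_inv_mul]
    rw [this]
    rfl
  rw [e1, (EuclideanSpace.volume_preserving_symm_measurableEquiv_toLp (Fin d)).measure_preimage_equiv]
  simp only [sub_eq_add_neg]
  rw [measure_preimage_add_right, Measure.addHaar_preimage_smul _ (inv_pos.2 hh).ne']
  congr 2
  rw [Module.finrank_fin_fun, inv_pow, inv_inv, abs_of_pos (pow_pos hh d)]

theorem sum_mul_prod_eq_tensorPoly {d k : ℕ} (B : Fin d → Matrix (Fin (k + 1)) (Fin (k + 1)) ℝ)
    (c : (Fin d → Fin (k + 1)) → ℝ) (t : Fin d → ℝ) :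
    ∑ a, c a * ∏ l, ∑ m, B l (a l) m * t l ^ (m : ℕ)
      = tensorPoly (fun m => ∑ a, c a * ∏ l, B l (a l) (m l)) t := by
  unfold tensorPoly
  simp only [Finset.prod_univ_sum, Fintype.piFinset_univ, Finset.mul_sum, Finset.sum_mul,
    Finset.prod_mul_distrib, mul_assoc]
  rw [Finset.sum_comm]

theorem eq_sum_mul_prod {d k : ℕ} {A B : Fin d → Matrix (Fin (k + 1)) (Fin (k + 1)) ℝ}
    (h : ∀ l, B l * A l = 1) (c : (Fin d → Fin (k + 1)) → ℝ) (a' : Fin d → Fin (k + 1)) :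
    c a' = ∑ m : Fin d → Fin (k + 1), (∑ a, c a * ∏ l, B l (a l) (m l)) * ∏ l, A l (m l) (a' l) := by
  have key : ∀ a : Fin d → Fin (k + 1),
      ∑ m : Fin d → Fin (k + 1), (∏ l, B l (a l) (m l)) * ∏ l, A l (m l) (a' l)
        = if a = a' then 1 else 0 := by
    intro a
    simp only [← Finset.prod_mul_distrib]
    rw [← Fintype.piFinset_univ,
      ← Finset.prod_univ_sum (fun _ => Finset.univ) fun l m => B l (a l) m * A l m (a' l)]
    have : ∀ l, ∑ m, B l (a l) m * A l m (a' l) = if a l = a' l then 1 else 0 := by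
      intro l
      rw [← Matrix.mul_apply, h l, Matrix.one_apply]
    simp only [this]
    rw [Finset.prod_ite_zero]
    simp [funext_iff]
  simp only [Finset.sum_mul, mul_assoc]
  rw [Finset.sum_comm]
  simp only [← Finset.mul_sum, key]
  simp

/-- Stability of the B-spline basis on one element, in the form of a sublevel set estimate. -/
theorem exists_volume_abs_sum_bspline_lt_le (d k : ℕ) (s : ℝ) {δ : ENNReal} (hδ : δ ≠ 0) :
    ∃ ε : ℝ, 0 < ε ∧ ∀ (ξ : Fin d → ℕ → ℝ) (μ : Fin d → ℕ) (h : ℝ), (∀ l, Monotone (ξ l)) →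
      0 < h → (∀ l, k ≤ μ l) → (∀ l, ξ l (μ l) < ξ l (μ l + 1)) →
      (∀ l i, ξ l (i + 1) - ξ l i ≤ s * h) → ∀ c : (Fin d → Fin (k + 1)) → ℝ,
      volume {x : EuclideanSpace ℝ (Fin d) |
          (∀ l, x l ∈ Set.Ico (ξ l (μ l)) (ξ l (μ l + 1))) ∧
          |∑ a, c a * ∏ l, bspline (ξ l) k (μ l - k + a l) (x l)| < ε * ‖c‖}
        ≤ ENNReal.ofReal (h ^ d) * δ := by
  obtain ⟨C, hC, hmat⟩ := exists_matrix_monomial_eq_sum_bspline k (k * s)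
  obtain ⟨ε, hε, hsub⟩ := exists_volume_abs_tensorPoly_lt_le d k s hδ
  set D : ℝ := Fintype.card (Fin d → Fin (k + 1)) * C ^ d with hD
  have hD0 : 0 < D := mul_pos (by exact_mod_cast Fintype.card_pos) (pow_pos hC d)
  refine ⟨ε / D, div_pos hε hD0, fun ξ μ h hξ hh hk hμ hgap c => ?_⟩
  have hA : ∀ l, ∃ A : Matrix (Fin (k + 1)) (Fin (k + 1)) ℝ, IsUnit A ∧ (∀ m a, |A m a| ≤ C) ∧
        ∀ x, ξ l (μ l) ≤ x → x < ξ l (μ l + 1) → ∀ m : Fin (k + 1),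
          ((x - ξ l (μ l)) / h) ^ (m : ℕ) = ∑ a, A m a * bspline (ξ l) k (μ l - k + a) x :=
    fun l => hmat (ξ l) (hξ l) (μ l) h (hk l) hh (hμ l) fun i h1 h2 =>
      (abs_sub_le_of_forall_sub_le (hξ l) (hgap l) h1 h2).trans_eq (by ring)
  choose A hAu hAC hAm using hA
  have hBA : ∀ l, (A l)⁻¹ * A l = 1 := fun l =>
    Matrix.nonsing_inv_mul _ ((Matrix.isUnit_iff_isUnit_det _).1 (hAu l))
  have hN : ∀ l x, ξ l (μ l) ≤ x → x < ξ l (μ l + 1) → ∀ a : Fin (k + 1),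
      bspline (ξ l) k (μ l - k + a) x
        = ∑ m, (A l)⁻¹ a m * ((x - ξ l (μ l)) / h) ^ (m : ℕ) := by
    intro l x hx hx' a
    have e : Matrix.mulVec (A l) (fun a : Fin (k + 1) => bspline (ξ l) k (μ l - k + a) x)
        = fun m : Fin (k + 1) => ((x - ξ l (μ l)) / h) ^ (m : ℕ) := by
      funext m
      exact (hAm l x hx hx' m).symm
    have := congrFun (congrArg (Matrix.mulVec (A l)⁻¹) e) a
    rw [Matrix.mulVec_mulVec, hBA, Matrix.one_mulVec] at this
    exact this
  set w : (Fin d → Fin (k + 1)) → ℝ := fun m => ∑ a, c a * ∏ l, (A l)⁻¹ (a l) (m l) with hw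
  -- The coefficients `c` are recovered from `w` through `A`, so only the bound on `A` is used; the
  -- entries of its inverse are never estimated.
  have hcw : ‖c‖ ≤ D * ‖w‖ := by
    rw [pi_norm_le_iff_of_nonneg (by positivity)]
    intro a
    rw [eq_sum_mul_prod hBA c a, Real.norm_eq_abs]
    refine (Finset.abs_sum_le_sum_abs _ _).trans ?_
    refine (Finset.sum_le_card_nsmul _ _ (C ^ d * ‖w‖) fun m _ => ?_).trans_eq ?_
    · rw [abs_mul, mul_comm, Finset.abs_prod]
      refine mul_le_mul ?_ (norm_le_pi_norm w m) (abs_nonneg _) (by positivity)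
      refine (Finset.prod_le_prod (fun _ _ => abs_nonneg _) fun l _ => hAC l _ _).trans_eq ?_
      simp
    · rw [nsmul_eq_mul, hD, mul_assoc]
      rfl
  refine le_trans (measure_mono ?_) ((volume_setOf_scaled_mem (fun l => ξ l (μ l)) hh _).trans_le
    (mul_le_mul_right (hsub w) _))
  rintro x ⟨hx, hx'⟩
  refine ⟨fun l => ?_, ?_⟩
  · rw [abs_of_nonneg (div_nonneg (sub_nonneg.2 (hx l).1) hh.le), div_le_iff₀ hh]
    have := hgap l (μ l)
    have := (hx l).2
    linarith
  · have e : ∑ a : Fin d → Fin (k + 1), c a * ∏ l, bspline (ξ l) k (μ l - k + a l) (x l)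
        = tensorPoly w fun l => (x l - ξ l (μ l)) / h := by
      rw [hw, ← sum_mul_prod_eq_tensorPoly]
      refine Finset.sum_congr rfl fun a _ => ?_
      congr 1
      exact Finset.prod_congr rfl fun l _ => hN l _ (hx l).1 (hx l).2 (a l)
    rw [e] at hx'
    refine hx'.trans_le ?_
    rw [div_mul_eq_mul_div, div_le_iff₀ hD0, mul_assoc]
    exact mul_le_mul_of_nonneg_left (hcw.trans_eq (mul_comm _ _)) hε.le

/-! ### Open knot vectors and their spans. -/

variable {d k : ℕ}

/-- The knots of an open knot vector, continued by the last knot. -/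
def OpenKnotVector.extKnot (Ξ : OpenKnotVector k) (i : ℕ) : ℝ := Ξ.knot (min i (Ξ.n + k))

theorem OpenKnotVector.extKnot_eq (Ξ : OpenKnotVector k) {i : ℕ} (hi : i ≤ Ξ.n + k) :
    Ξ.extKnot i = Ξ.knot i := by
  rw [extKnot, min_eq_left hi]

theorem OpenKnotVector.monotone_extKnot (Ξ : OpenKnotVector k) : Monotone Ξ.extKnot :=
  fun _ _ h => Ξ.mono _ _ (min_le_min_right _ h) (min_le_right _ _)

theorem OpenKnotVector.n_pos (Ξ : OpenKnotVector k) : 0 < Ξ.n := by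
  by_contra h
  have h0 : Ξ.n = 0 := by omega
  have := Ξ.lt_last
  simp [h0] at this

/-- Gives access to the B-spline lemmas, which ask for a sequence monotone on all of `ℕ`. -/
theorem OpenKnotVector.bspline_extKnot (Ξ : OpenKnotVector k) {i : ℕ} (hi : i < Ξ.n) :
    bspline Ξ.knot k i = bspline Ξ.extKnot k i :=
  bspline_congr fun _ _ h => (Ξ.extKnot_eq (by omega)).symm

/-- `j` is the index of a nonempty knot span. -/
def OpenKnotVector.IsSpan (Ξ : OpenKnotVector k) (j : ℕ) : Prop :=
  j < Ξ.n + k ∧ Ξ.knot j < Ξ.knot (j + 1)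

theorem OpenKnotVector.isSpan_first (Ξ : OpenKnotVector k) : Ξ.IsSpan k :=
  ⟨by have := Ξ.n_pos; omega, Ξ.first_lt⟩

theorem OpenKnotVector.IsSpan.le {Ξ : OpenKnotVector k} {j : ℕ} (h : Ξ.IsSpan j) : k ≤ j := by
  by_contra hj
  have h1 := Ξ.first_eq j (by omega)
  have h2 := Ξ.first_eq (j + 1) (by omega)
  have := h.2
  linarith

theorem OpenKnotVector.IsSpan.lt {Ξ : OpenKnotVector k} {j : ℕ} (h : Ξ.IsSpan j) : j < Ξ.n := by
  by_contra hj
  have h0 := h.1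
  have h1 := Ξ.last_eq j (by omega) (by omega)
  have h2 := Ξ.last_eq (j + 1) (by omega) (by omega)
  have := h.2
  linarith

theorem OpenKnotVector.IsSpan.extKnot_eq {Ξ : OpenKnotVector k} {j : ℕ} (h : Ξ.IsSpan j) :
    Ξ.extKnot j = Ξ.knot j :=
  Ξ.extKnot_eq h.1.le

theorem OpenKnotVector.IsSpan.extKnot_succ_eq {Ξ : OpenKnotVector k} {j : ℕ} (h : Ξ.IsSpan j) :
    Ξ.extKnot (j + 1) = Ξ.knot (j + 1) :=
  Ξ.extKnot_eq h.1

theorem OpenKnotVector.exists_isSpan (Ξ : OpenKnotVector k) {x : ℝ} (hx : x ∈ Set.Ioo (0 : ℝ) 1) :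
    ∃ j, Ξ.IsSpan j ∧ x ∈ Set.Ico (Ξ.knot j) (Ξ.knot (j + 1)) := by
  have hex : ∃ m, m ≤ Ξ.n ∧ x < Ξ.knot m :=
    ⟨Ξ.n, le_rfl, by rw [Ξ.last_eq Ξ.n le_rfl (by omega)]; exact hx.2⟩
  classical
  set m := Nat.find hex with hm
  have hspec := Nat.find_spec hex
  rw [← hm] at hspec
  have hm0 : m ≠ 0 := by
    intro h0
    have := hspec.2
    rw [h0, Ξ.first_eq 0 (Nat.zero_le _)] at this
    exact absurd hx.1 this.not_gt
  obtain ⟨j, hj⟩ := Nat.exists_eq_succ_of_ne_zero hm0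
  rw [hj] at hspec
  have hlt : Ξ.knot j ≤ x := by
    by_contra h
    refine Nat.find_min hex (m := j) (by omega) ⟨by omega, not_le.1 h⟩
  exact ⟨j, ⟨by omega, hlt.trans_lt hspec.2⟩, hlt, hspec.2⟩

theorem OpenKnotVector.extKnot_succ_sub_le (Ξ : OpenKnotVector k) {g : ℝ} (hg : 0 ≤ g)
    (h : ∀ j, Ξ.IsSpan j → Ξ.knot (j + 1) - Ξ.knot j ≤ g) (i : ℕ) :
    Ξ.extKnot (i + 1) - Ξ.extKnot i ≤ g := by
  by_cases hi : i < Ξ.n + k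
  · rw [Ξ.extKnot_eq hi.le, Ξ.extKnot_eq hi]
    by_cases hlt : Ξ.knot i < Ξ.knot (i + 1)
    · exact h i ⟨hi, hlt⟩
    · linarith
  · rw [extKnot, extKnot, min_eq_right (by omega), min_eq_right (by omega), sub_self]
    exact hg

theorem OpenKnotVector.knot_nonneg (Ξ : OpenKnotVector k) {j : ℕ} (hj : j ≤ Ξ.n + k) :
    0 ≤ Ξ.knot j :=
  (Ξ.first_eq 0 (Nat.zero_le _)).ge.trans (Ξ.mono _ _ (Nat.zero_le _) hj)

theorem OpenKnotVector.knot_le_one (Ξ : OpenKnotVector k) {j : ℕ} (hj : j ≤ Ξ.n + k) :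
    Ξ.knot j ≤ 1 :=
  (Ξ.mono _ _ hj le_rfl).trans (Ξ.last_eq _ (by omega) le_rfl).le

theorem OpenKnotVector.IsSpan.eq_of_mem {Ξ : OpenKnotVector k} {i j : ℕ} (hi : Ξ.IsSpan i)
    (hj : Ξ.IsSpan j) {x : ℝ} (hxi : x ∈ Set.Ico (Ξ.knot i) (Ξ.knot (i + 1)))
    (hxj : x ∈ Set.Ico (Ξ.knot j) (Ξ.knot (j + 1))) : i = j := by
  by_contra hne
  rcases Nat.lt_or_gt_of_ne hne with h | h
  · have := Ξ.mono (i + 1) j h hj.1.le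
    linarith [hxi.2, hxj.1]
  · have := Ξ.mono (j + 1) i h hi.1.le
    linarith [hxj.2, hxi.1]

/-- A B-spline whose support does not contain the span `μ` vanishes on the closure of the span,
up to the end points of `[0,1]`. -/
theorem OpenKnotVector.bspline_eq_zero_of_not_active (Ξ : OpenKnotVector k) {i μ : ℕ}
    (hi : i < Ξ.n) (hμ : Ξ.IsSpan μ) (h : ¬(i ≤ μ ∧ μ ≤ i + k)) {x : ℝ}
    (hx : x ∈ Set.Ioo (0 : ℝ) 1) (hxμ : x ∈ Set.Icc (Ξ.knot μ) (Ξ.knot (μ + 1))) :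
    bspline Ξ.knot k i x = 0 := by
  rw [Ξ.bspline_extKnot hi]
  have hmono := Ξ.monotone_extKnot
  rw [← hμ.extKnot_eq, ← hμ.extKnot_succ_eq] at hxμ
  by_cases h1 : i ≤ μ
  · exact bspline_eq_zero_of_ge hmono ((hmono (by omega)).trans hxμ.1)
  · have hle : x ≤ Ξ.extKnot i := hxμ.2.trans (hmono (by omega))
    rcases hle.lt_or_eq with hlt | heq
    · exact bspline_eq_zero_of_lt hmono hlt
    -- Here `x` is the left end of the support; the spline could be nonzero there only if the `k +
    -- 1` knots `i, …, i + k` all coincided with the interior point `x`.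
    · rw [heq]
      apply bspline_left_eq_zero hmono
      refine (hmono (Nat.le_add_right i k)).lt_of_ne fun hik => ?_
      have hmul := Ξ.mult_le x hx.1 hx.2
      have hsub : (Finset.Icc i (i + k) : Set ℕ) ⊆ {j | j ≤ Ξ.n + k ∧ Ξ.knot j = x} := by
        intro j hj
        have hj := Finset.mem_Icc.1 (Finset.mem_coe.1 hj)
        have hjn : j ≤ Ξ.n + k := by omega
        refine ⟨hjn, ?_⟩
        rw [← Ξ.extKnot_eq hjn, heq]
        exact le_antisymm ((hmono hj.2).trans hik.ge) (hmono hj.1)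
      have hfin : {j | j ≤ Ξ.n + k ∧ Ξ.knot j = x}.Finite :=
        (Set.finite_Iic (Ξ.n + k)).subset fun j hj => hj.1
      have hcard := Set.ncard_le_ncard hsub hfin
      rw [Set.ncard_coe_finset, Nat.card_Icc] at hcard
      omega

/-! ### Boxes and quasi-uniformity of the mesh. -/

theorem volume_setOf_forall_mem (S : Fin d → Set ℝ) :
    volume {x : EuclideanSpace ℝ (Fin d) | ∀ l, x l ∈ S l} = ∏ l, volume (S l) := by
  rw [← volume_pi_pi, ← (EuclideanSpace.volume_preserving_symm_measurableEquiv_toLp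
    (Fin d)).measure_preimage_equiv]
  congr 1
  ext x
  simp only [Set.mem_ofPred_eq, Set.mem_preimage, Set.mem_univ_pi]
  rfl

theorem isBounded_paramElement (Ξ : Fin d → OpenKnotVector k) (j : Fin d → ℕ) :
    Bornology.IsBounded (paramElement Ξ j) := by
  have h : Bornology.IsBounded (Set.univ.pi fun l : Fin d =>
      Set.Ioo ((Ξ l).knot (j l)) ((Ξ l).knot (j l + 1))) :=
    Bornology.IsBounded.pi fun l => Metric.isBounded_Ioo _ _
  refine ((PiLp.antilipschitzWith_ofLp 2 fun _ : Fin d => ℝ).isBounded_preimage h).subset ?_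
  intro x hx l _
  exact hx l

theorem sub_le_diam_paramElement {Ξ : Fin d → OpenKnotVector k} {j : Fin d → ℕ}
    (hj : IsElementIndex Ξ j) (l : Fin d) :
    (Ξ l).knot (j l + 1) - (Ξ l).knot (j l) ≤ Metric.diam (paramElement Ξ j) := by
  have hlip : LipschitzWith 1 fun x : EuclideanSpace ℝ (Fin d) => x l :=
    LipschitzWith.of_dist_le_mul fun x y => by
      rw [NNReal.coe_one, one_mul, EuclideanSpace.dist_eq]
      refine Real.le_sqrt_of_sq_le ?_
      exact Finset.single_le_sum (f := fun i => dist (x i) (y i) ^ 2) (fun _ _ => sq_nonneg _)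
        (Finset.mem_univ l)
  have := hlip.diam_image_le _ (isBounded_paramElement Ξ j)
  rw [NNReal.coe_one, one_mul] at this
  rw [← Real.diam_Ioo (hj l).2.le]
  refine le_trans (Metric.diam_mono ?_ (hlip.isBounded_image (isBounded_paramElement Ξ j))) this
  intro t ht
  refine ⟨WithLp.toLp 2 (Function.update
    (fun l => ((Ξ l).knot (j l) + (Ξ l).knot (j l + 1)) / 2) l t), fun m => ?_, by simp⟩
  by_cases hm : m = l
  · subst hm
    simpa using ht
  · have := (hj m).2
    simp only [Function.update_of_ne hm]
    constructor <;> linarith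

/-- Shape regularity in more than one direction makes the mesh quasi-uniform. -/
theorem IsShapeRegular.exists_meshSize (hd : 2 ≤ d) {σ : ℝ} {Ξ : Fin d → OpenKnotVector k}
    (h : IsShapeRegular σ Ξ) : ∃ h : ℝ, 0 < h ∧ ∀ l j, (Ξ l).IsSpan j →
      h ≤ max σ 1 ^ 2 * ((Ξ l).knot (j + 1) - (Ξ l).knot j) ∧
      (Ξ l).knot (j + 1) - (Ξ l).knot j ≤ max σ 1 ^ 2 * h := by
  set t := max σ 1 with ht
  have ht1 : 1 ≤ t := le_max_right _ _
  -- Any two spans in different directions are edges of a common element, hence comparable.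
  have key : ∀ l m, l ≠ m → ∀ i j, (Ξ l).IsSpan i → (Ξ m).IsSpan j →
      (Ξ l).knot (i + 1) - (Ξ l).knot i ≤ t * ((Ξ m).knot (j + 1) - (Ξ m).knot j) := by
    intro l m hlm i j hi hj
    have hJ : IsElementIndex Ξ (Function.update (Function.update (fun _ => k) l i) m j) := by
      intro r
      by_cases hr : r = m
      · subst hr; simpa [OpenKnotVector.IsSpan] using hj
      rw [Function.update_of_ne hr]
      by_cases hr' : r = l
      · subst hr'; simpa [OpenKnotVector.IsSpan] using hi
      rw [Function.update_of_ne hr']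
      exact (Ξ r).isSpan_first
    have h1 := sub_le_diam_paramElement hJ l
    have h2 := h _ hJ m
    rw [Function.update_of_ne hlm] at h1
    simp only [Function.update_self] at h1 h2
    refine h1.trans (h2.trans ?_)
    exact mul_le_mul_of_nonneg_right (le_max_left _ _) (sub_nonneg.2 hj.2.le)
  set l₀ : Fin d := ⟨0, by omega⟩
  set l₁ : Fin d := ⟨1, by omega⟩
  have h01 : l₀ ≠ l₁ := by simp [l₀, l₁]
  have hpos : ∀ l j, (Ξ l).IsSpan j → 0 < (Ξ l).knot (j + 1) - (Ξ l).knot j :=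
    fun l j hj => sub_pos.2 hj.2
  have htt : ∀ a b : ℝ, 0 < b → a ≤ t * b → a ≤ t ^ 2 * b := fun a b hb hab =>
    hab.trans (mul_le_mul_of_nonneg_right (by nlinarith) hb.le)
  -- The reference length is the first span in direction `l₀`. Spans of that same direction are
  -- compared through direction `l₁`, whence the square of `t`.
  refine ⟨(Ξ l₀).knot (k + 1) - (Ξ l₀).knot k, hpos _ _ (Ξ l₀).isSpan_first, fun l j hj => ?_⟩
  by_cases hl : l = l₀
  · subst hl
    have f0 := (Ξ l₀).isSpan_first
    have f1 := (Ξ l₁).isSpan_first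
    have hh : ∀ a b c : ℝ, a ≤ t * b → b ≤ t * c → a ≤ t ^ 2 * c := fun a b c hab hbc => by
      rw [sq, mul_assoc]
      exact hab.trans (mul_le_mul_of_nonneg_left hbc (by linarith))
    exact ⟨hh _ _ _ (key _ _ h01 _ _ f0 f1) (key _ _ h01.symm _ _ f1 hj),
      hh _ _ _ (key _ _ h01 _ _ hj f1) (key _ _ h01.symm _ _ f1 f0)⟩
  · exact ⟨htt _ _ (hpos _ _ hj) (key _ _ (Ne.symm hl) _ _ (Ξ l₀).isSpan_first hj),
      htt _ _ (hpos _ _ (Ξ l₀).isSpan_first) (key _ _ hl _ _ hj (Ξ l₀).isSpan_first)⟩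

/-! ### Splines, their coefficients, and the indices active on an element. -/

/-- The multi-indices of the tensor-product B-splines. -/
def splineIndices (Ξ : Fin d → OpenKnotVector k) : Finset (Fin d → ℕ) :=
  Fintype.piFinset fun l => Finset.range (Ξ l).n

theorem mem_splineIndices {Ξ : Fin d → OpenKnotVector k} {i : Fin d → ℕ} :
    i ∈ splineIndices Ξ ↔ ∀ l, i l < (Ξ l).n := by
  simp [splineIndices]

/-- The B-spline `i` of degree `k` does not vanish identically on the element `μ`. -/
def IsActive (k : ℕ) (i μ : Fin d → ℕ) : Prop := ∀ l, i l ≤ μ l ∧ μ l ≤ i l + k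

/-- The spline with coefficients `c`. -/
def splineOf (Ξ : Fin d → OpenKnotVector k) (c : (Fin d → ℕ) → ℝ) :
    EuclideanSpace ℝ (Fin d) → ℝ :=
  fun x => ∑ i ∈ splineIndices Ξ, c i * tensorBSpline Ξ i x

theorem splineOf_mem (Ξ : Fin d → OpenKnotVector k) (c : (Fin d → ℕ) → ℝ) :
    splineOf Ξ c ∈ splineSpace Ξ := by
  have : splineOf Ξ c = ∑ i ∈ splineIndices Ξ, c i • tensorBSpline Ξ i := by
    funext x
    simp [splineOf]
  rw [this]
  exact Submodule.sum_mem _ fun i hi => Submodule.smul_mem _ _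
    (Submodule.subset_span ⟨i, mem_splineIndices.1 hi, rfl⟩)

theorem exists_eq_splineOf {Ξ : Fin d → OpenKnotVector k} {s : EuclideanSpace ℝ (Fin d) → ℝ}
    (hs : s ∈ splineSpace Ξ) : ∃ c, s = splineOf Ξ c := by
  have : {b | ∃ i : Fin d → ℕ, (∀ l, i l < (Ξ l).n) ∧ b = tensorBSpline Ξ i}
      = tensorBSpline Ξ '' ↑(splineIndices Ξ) := by
    ext b
    simp only [Set.mem_ofPred_eq, Set.mem_image, Finset.mem_coe, mem_splineIndices, eq_comm]
  rw [splineSpace, this, Submodule.mem_span_image_finset_iff_exists_fun'] at hs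
  obtain ⟨c, hc⟩ := hs
  refine ⟨c, ?_⟩
  funext x
  rw [← hc]
  simp [splineOf]

theorem measurable_tensorBSpline (Ξ : Fin d → OpenKnotVector k) (i : Fin d → ℕ) :
    Measurable (tensorBSpline Ξ i) := by
  unfold tensorBSpline
  refine Finset.measurable_fun_prod _ fun l _ => (measurable_bspline _ _ _).comp ?_
  fun_prop

theorem measurable_splineOf (Ξ : Fin d → OpenKnotVector k) (c : (Fin d → ℕ) → ℝ) :
    Measurable (splineOf Ξ c) :=
  Finset.measurable_fun_sum _ fun i _ => (measurable_tensorBSpline Ξ i).const_mul (c i)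

theorem abs_tensorBSpline_le (Ξ : Fin d → OpenKnotVector k) {i : Fin d → ℕ}
    (hi : i ∈ splineIndices Ξ) (x : EuclideanSpace ℝ (Fin d)) :
    |tensorBSpline Ξ i x| ≤ (2 ^ k) ^ d := by
  rw [tensorBSpline, Finset.abs_prod]
  refine (Finset.prod_le_prod (fun _ _ => abs_nonneg _) fun l _ => ?_).trans_eq
    (by rw [Finset.prod_const, Finset.card_univ, Fintype.card_fin])
  rw [(Ξ l).bspline_extKnot (mem_splineIndices.1 hi l)]
  exact abs_bspline_le (Ξ l).monotone_extKnot _ _ _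

/-- The closed box with the same vertices as the element `μ`. -/
def closedElement (Ξ : Fin d → OpenKnotVector k) (μ : Fin d → ℕ) :
    Set (EuclideanSpace ℝ (Fin d)) :=
  {x | ∀ l, x l ∈ Set.Icc ((Ξ l).knot (μ l)) ((Ξ l).knot (μ l + 1))}

theorem closure_paramElement_subset (Ξ : Fin d → OpenKnotVector k) (μ : Fin d → ℕ) :
    closure (paramElement Ξ μ) ⊆ closedElement Ξ μ := by
  refine closure_minimal (fun x hx l => Set.Ioo_subset_Icc_self (hx l)) ?_
  have : closedElement Ξ μ = ⋂ l, (fun x : EuclideanSpace ℝ (Fin d) => x l) ⁻¹'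
      Set.Icc ((Ξ l).knot (μ l)) ((Ξ l).knot (μ l + 1)) := by
    ext x
    simp only [closedElement, Set.mem_iInter]
    rfl
  rw [this]
  exact isClosed_iInter fun l => isClosed_Icc.preimage (by fun_prop)

theorem isOpen_paramElement (Ξ : Fin d → OpenKnotVector k) (μ : Fin d → ℕ) :
    IsOpen (paramElement Ξ μ) := by
  have : paramElement Ξ μ = ⋂ l, (fun x : EuclideanSpace ℝ (Fin d) => x l) ⁻¹'
      Set.Ioo ((Ξ l).knot (μ l)) ((Ξ l).knot (μ l + 1)) := by
    ext x
    simp only [paramElement, Set.mem_iInter]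
    rfl
  rw [this]
  exact isOpen_iInter_of_finite fun l => isOpen_Ioo.preimage (by fun_prop)

theorem isOpen_paramCube (d : ℕ) : IsOpen (paramCube d) := by
  have : paramCube d = ⋂ l, (fun x : EuclideanSpace ℝ (Fin d) => x l) ⁻¹'
      Set.Ioo 0 1 := by
    ext x
    simp only [paramCube, Set.mem_iInter]
    rfl
  rw [this]
  exact isOpen_iInter_of_finite fun l => isOpen_Ioo.preimage (by fun_prop)

theorem paramElement_subset_paramCube {Ξ : Fin d → OpenKnotVector k} {μ : Fin d → ℕ}
    (hμ : IsElementIndex Ξ μ) : paramElement Ξ μ ⊆ paramCube d := fun _ hx l =>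
  ⟨((Ξ l).knot_nonneg (hμ l).1.le).trans_lt (hx l).1,
    (hx l).2.trans_le ((Ξ l).knot_le_one (hμ l).1)⟩

/-- The half-open box with the same vertices as the element `μ`, cut with the open cube. -/
def halfOpenElement (Ξ : Fin d → OpenKnotVector k) (μ : Fin d → ℕ) :
    Set (EuclideanSpace ℝ (Fin d)) :=
  {x | ∀ l, x l ∈ Set.Ico ((Ξ l).knot (μ l)) ((Ξ l).knot (μ l + 1))} ∩ paramCube d

theorem measurableSet_halfOpenElement (Ξ : Fin d → OpenKnotVector k) (μ : Fin d → ℕ) :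
    MeasurableSet (halfOpenElement Ξ μ) := by
  refine MeasurableSet.inter ?_ (isOpen_paramCube d).measurableSet
  have : {x : EuclideanSpace ℝ (Fin d) |
      ∀ l, x l ∈ Set.Ico ((Ξ l).knot (μ l)) ((Ξ l).knot (μ l + 1))} =
      ⋂ l, (fun x : EuclideanSpace ℝ (Fin d) => x l) ⁻¹'
      Set.Ico ((Ξ l).knot (μ l)) ((Ξ l).knot (μ l + 1)) := by
    ext x
    simp only [Set.mem_iInter]
    rfl
  rw [this]
  exact MeasurableSet.iInter fun l => measurableSet_Ico.preimage (by fun_prop)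

theorem exists_mem_halfOpenElement (Ξ : Fin d → OpenKnotVector k)
    {x : EuclideanSpace ℝ (Fin d)} (hx : x ∈ paramCube d) :
    ∃ μ, IsElementIndex Ξ μ ∧ x ∈ halfOpenElement Ξ μ := by
  choose μ h1 h2 using fun l => (Ξ l).exists_isSpan (hx l)
  exact ⟨μ, h1, h2, hx⟩

theorem IsElementIndex.eq_of_mem {Ξ : Fin d → OpenKnotVector k} {μ ν : Fin d → ℕ}
    (hμ : IsElementIndex Ξ μ) (hν : IsElementIndex Ξ ν) {x : EuclideanSpace ℝ (Fin d)}
    (hxμ : x ∈ paramElement Ξ μ) (hxν : x ∈ paramElement Ξ ν) : μ = ν :=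
  funext fun l => OpenKnotVector.IsSpan.eq_of_mem (hμ l) (hν l)
    (Set.Ioo_subset_Ico_self (hxμ l)) (Set.Ioo_subset_Ico_self (hxν l))

theorem tensorBSpline_eq_zero {Ξ : Fin d → OpenKnotVector k} {i μ : Fin d → ℕ}
    (hi : i ∈ splineIndices Ξ) (hμ : IsElementIndex Ξ μ) (h : ¬IsActive k i μ)
    {x : EuclideanSpace ℝ (Fin d)} (hx : x ∈ paramCube d) (hxμ : x ∈ closedElement Ξ μ) :
    tensorBSpline Ξ i x = 0 := by
  obtain ⟨l, hl⟩ := not_forall.1 h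
  exact Finset.prod_eq_zero (Finset.mem_univ l)
    ((Ξ l).bspline_eq_zero_of_not_active (mem_splineIndices.1 hi l) (hμ l) hl (hx l) (hxμ l))

theorem splineOf_congr {Ξ : Fin d → OpenKnotVector k} {c c' : (Fin d → ℕ) → ℝ}
    {μ : Fin d → ℕ} (hμ : IsElementIndex Ξ μ) (h : ∀ i, IsActive k i μ → c i = c' i)
    {x : EuclideanSpace ℝ (Fin d)} (hx : x ∈ paramCube d) (hxμ : x ∈ closedElement Ξ μ) :
    splineOf Ξ c x = splineOf Ξ c' x := by
  refine Finset.sum_congr rfl fun i hi => ?_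
  by_cases ha : IsActive k i μ
  · rw [h i ha]
  · rw [tensorBSpline_eq_zero hi hμ ha hx hxμ, mul_zero, mul_zero]

theorem paramElement_subset_closedElement (Ξ : Fin d → OpenKnotVector k) (μ : Fin d → ℕ) :
    paramElement Ξ μ ⊆ closedElement Ξ μ := fun _ hx l => Set.Ioo_subset_Icc_self (hx l)

theorem halfOpenElement_subset_closedElement (Ξ : Fin d → OpenKnotVector k) (μ : Fin d → ℕ) :
    halfOpenElement Ξ μ ⊆ closedElement Ξ μ := fun _ hx l => Set.Ico_subset_Icc_self (hx.1 l)

/-- The indices of the B-splines which are active on the element `μ`. -/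
def activeIndices (k : ℕ) (μ : Fin d → ℕ) : Finset (Fin d → ℕ) :=
  Fintype.piFinset fun l => Finset.Icc (μ l - k) (μ l)

theorem mem_activeIndices {i μ : Fin d → ℕ} : i ∈ activeIndices k μ ↔ IsActive k i μ := by
  simp only [activeIndices, Fintype.mem_piFinset, Finset.mem_Icc, IsActive]
  exact forall_congr' fun l => by omega

theorem IsActive.mem_splineIndices {Ξ : Fin d → OpenKnotVector k} {i μ : Fin d → ℕ}
    (h : IsActive k i μ) (hμ : IsElementIndex Ξ μ) : i ∈ splineIndices Ξ :=
  _root_.mem_splineIndices.2 fun l => (h l).1.trans_lt (OpenKnotVector.IsSpan.lt (hμ l))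

theorem card_activeIndices_le (k : ℕ) (μ : Fin d → ℕ) :
    (activeIndices k μ).card ≤ (k + 1) ^ d := by
  rw [activeIndices, Fintype.card_piFinset]
  refine (Finset.prod_le_prod' (g := fun _ => k + 1) fun l _ => ?_).trans_eq (by simp)
  rw [Nat.card_Icc]
  omega

theorem splineOf_eq_sum_activeIndices {Ξ : Fin d → OpenKnotVector k} (c : (Fin d → ℕ) → ℝ)
    {μ : Fin d → ℕ} (hμ : IsElementIndex Ξ μ) {x : EuclideanSpace ℝ (Fin d)}
    (hx : x ∈ paramCube d) (hxμ : x ∈ closedElement Ξ μ) :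
    splineOf Ξ c x = ∑ i ∈ activeIndices k μ, c i * tensorBSpline Ξ i x := by
  symm
  refine Finset.sum_subset (fun i hi => (mem_activeIndices.1 hi).mem_splineIndices hμ) ?_
  intro i hi hia
  rw [tensorBSpline_eq_zero hi hμ (fun h => hia (mem_activeIndices.2 h)) hx hxμ, mul_zero]

theorem splineOf_eq_sum_fin {Ξ : Fin d → OpenKnotVector k} (c : (Fin d → ℕ) → ℝ)
    {μ : Fin d → ℕ} (hμ : IsElementIndex Ξ μ) {x : EuclideanSpace ℝ (Fin d)}
    (hx : x ∈ paramCube d) (hxμ : x ∈ closedElement Ξ μ) :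
    splineOf Ξ c x = ∑ a : Fin d → Fin (k + 1), c (fun l => μ l - k + a l) *
      ∏ l, bspline (Ξ l).extKnot k (μ l - k + a l) (x l) := by
  have hk : ∀ l, k ≤ μ l := fun l => OpenKnotVector.IsSpan.le (hμ l)
  have hlt : ∀ l, μ l < (Ξ l).n := fun l => OpenKnotVector.IsSpan.lt (hμ l)
  rw [splineOf_eq_sum_activeIndices c hμ hx hxμ]
  symm
  refine Finset.sum_bij (fun a _ l => μ l - k + a l) ?_ ?_ ?_ ?_
  · intro a _
    rw [mem_activeIndices]
    intro l
    have := (a l).2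
    have := hk l
    change μ l - k + (a l : ℕ) ≤ μ l ∧ μ l ≤ μ l - k + (a l : ℕ) + k
    omega
  · intro a _ b _ hab
    funext l
    have := congrFun hab l
    exact Fin.ext (by simpa using this)
  · intro i hi
    have hi := mem_activeIndices.1 hi
    refine ⟨fun l => ⟨i l - (μ l - k), ?_⟩, Finset.mem_univ _, ?_⟩
    · have := hi l
      omega
    · funext l
      have := hi l
      change μ l - k + (i l - (μ l - k)) = i l
      omega
  · intro a _
    rw [tensorBSpline]
    congr 1
    refine Finset.prod_congr rfl fun l _ => ?_
    have := (a l).2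
    have := hk l
    have := hlt l
    rw [(Ξ l).bspline_extKnot (by omega)]

theorem abs_coeff_le_norm {c : (Fin d → ℕ) → ℝ} {i μ : Fin d → ℕ} (hi : IsActive k i μ) :
    |c i| ≤ ‖fun a : Fin d → Fin (k + 1) => c fun l => μ l - k + a l‖ := by
  have := norm_le_pi_norm (fun a : Fin d → Fin (k + 1) => c fun l => μ l - k + a l)
    fun l => ⟨i l - (μ l - k), by have := hi l; omega⟩
  refine le_trans (le_of_eq ?_) this
  rw [Real.norm_eq_abs]
  congr 2
  funext l
  have := hi l
  change i l = μ l - k + (i l - (μ l - k))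
  omega

/-! ### Local estimates between coefficients and integrals. -/

theorem volume_paramCube (d : ℕ) : volume (paramCube d) = 1 := by
  have := volume_setOf_forall_mem fun _ : Fin d => Set.Ioo (0 : ℝ) 1
  simpa [paramCube] using this

theorem volume_ne_top_of_subset_paramCube {A : Set (EuclideanSpace ℝ (Fin d))}
    (hA : A ⊆ paramCube d) : volume A ≠ ⊤ :=
  ((measure_mono hA).trans_lt (by rw [volume_paramCube]; exact ENNReal.one_lt_top)).ne

theorem IsBiLipschitzOn.exists_volumeReal_image_le
    {F : EuclideanSpace ℝ (Fin d) → EuclideanSpace ℝ (Fin d)}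
    (hF : IsBiLipschitzOn F (paramCube d)) : ∃ c : ℝ, 0 < c ∧ ∀ A ⊆ paramCube d,
      volume (F '' A) ≠ ⊤ ∧ volume.real (F '' A) ≤ c * volume.real A ∧
      volume.real A ≤ c * volume.real (F '' A) := by
  obtain ⟨c, hc, h⟩ := hF.exists_volume_image_le
  refine ⟨c, hc, fun A hA => ?_⟩
  have h1 := volume_ne_top_of_subset_paramCube hA
  obtain ⟨h2, h3⟩ := h A hA
  have h4 : volume (F '' A) ≠ ⊤ := (h2.trans_lt (ENNReal.mul_lt_top ENNReal.coe_lt_top h1.lt_top)).ne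
  refine ⟨h4, ?_, ?_⟩
  · have := ENNReal.toReal_mono (ENNReal.mul_ne_top ENNReal.coe_ne_top h1) h2
    simpa [Measure.real] using this
  · have := ENNReal.toReal_mono (ENNReal.mul_ne_top ENNReal.coe_ne_top h4) h3
    simpa [Measure.real] using this

theorem le_volumeReal_paramElement {Ξ : Fin d → OpenKnotVector k} {μ : Fin d → ℕ} {g : ℝ}
    (hg0 : 0 ≤ g) (hg : ∀ l, g ≤ (Ξ l).knot (μ l + 1) - (Ξ l).knot (μ l)) :
    g ^ d ≤ volume.real (paramElement Ξ μ) := by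
  rw [Measure.real, paramElement, volume_setOf_forall_mem, ENNReal.toReal_prod]
  refine le_trans (by simp) (Finset.prod_le_prod (f := fun _ => g) (fun _ _ => hg0) fun l _ => ?_)
  rw [Real.volume_Ioo, ENNReal.toReal_ofReal (hg0.trans (hg l))]
  exact hg l

theorem volumeReal_halfOpenElement_le {Ξ : Fin d → OpenKnotVector k} {μ : Fin d → ℕ} {g : ℝ}
    (hg0 : 0 ≤ g) (hg : ∀ l, (Ξ l).knot (μ l + 1) - (Ξ l).knot (μ l) ≤ g) :
    volume.real (halfOpenElement Ξ μ) ≤ g ^ d := by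
  refine ENNReal.toReal_le_of_le_ofReal (pow_nonneg hg0 d) ?_
  refine (measure_mono Set.inter_subset_left).trans ?_
  rw [volume_setOf_forall_mem, ENNReal.ofReal_pow hg0]
  refine (Finset.prod_le_prod' (g := fun _ => ENNReal.ofReal g) fun l _ => ?_).trans_eq (by simp)
  rw [Real.volume_Ico]
  exact ENNReal.ofReal_le_ofReal (hg l)

theorem enorm_sq_eq_ofReal (x : ℝ) : ‖x‖ₑ ^ 2 = ENNReal.ofReal (x ^ 2) := by
  rw [Real.enorm_eq_ofReal_abs, ← ENNReal.ofReal_pow (abs_nonneg x), sq_abs]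

/-- The set where the spline is small relative to its local coefficients has image of at most half
the volume guaranteed for the kept part of a good element. Integrating over the rest bounds every
active coefficient. -/
theorem exists_le_setLIntegral_of_good
    {F : EuclideanSpace ℝ (Fin d) → EuclideanSpace ℝ (Fin d)}
    (hF : IsBiLipschitzOn F (paramCube d)) (k : ℕ) {θ s : ℝ} (hθ : 0 < θ) (hs : 0 < s) :
    ∃ κ : ℝ, 0 < κ ∧ ∀ (Ξ : Fin d → OpenKnotVector k) (h : ℝ), 0 < h →
      (∀ l j, (Ξ l).IsSpan j → h ≤ s * ((Ξ l).knot (j + 1) - (Ξ l).knot j) ∧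
        (Ξ l).knot (j + 1) - (Ξ l).knot j ≤ s * h) →
      ∀ Ω : Set (EuclideanSpace ℝ (Fin d)), MeasurableSet Ω → ∀ (c : (Fin d → ℕ) → ℝ)
        (q : EuclideanSpace ℝ (Fin d) → ℝ),
      (∀ y ∈ paramCube d, F y ∈ Ω → q (F y) = splineOf Ξ c y) → ∀ μ, IsElementIndex Ξ μ →
      θ ≤ volume.real (F '' paramElement Ξ μ ∩ Ω) / volume.real (F '' paramElement Ξ μ) →
      ∀ i, IsActive k i μ → ENNReal.ofReal (κ * h ^ d * c i ^ 2) ≤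
        ∫⁻ x in F '' paramElement Ξ μ ∩ Ω, ‖q x‖ₑ ^ 2 := by
  obtain ⟨c₀, hc₀, hvol⟩ := hF.exists_volumeReal_image_le
  -- Chosen so that `c₀ * δ * h ^ d`, the bound for the volume of `F '' Z`, is half of `θ * (h / s)
  -- ^ d / c₀`, a lower bound for that of `F '' Q ∩ Ω`.
  set δ : ℝ := θ / (2 * s ^ d * c₀ ^ 2) with hδ
  have hδ0 : 0 < δ := by positivity
  obtain ⟨ε, hε, hstab⟩ := exists_volume_abs_sum_bspline_lt_le d k s (δ := ENNReal.ofReal δ)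
    (by simpa using hδ0)
  refine ⟨ε ^ 2 * (c₀ * δ), by positivity, fun Ξ h hh hgap Ω hΩ c q hq μ hμ hgood i hi => ?_⟩
  set Q := paramElement Ξ μ with hQ
  have hQc : Q ⊆ paramCube d := paramElement_subset_paramCube hμ
  set c' : (Fin d → Fin (k + 1)) → ℝ := fun a => c fun l => μ l - k + a l with hc'
  set Z : Set (EuclideanSpace ℝ (Fin d)) := Q ∩ {x | |splineOf Ξ c x| < ε * ‖c'‖} with hZ
  have hZm : MeasurableSet Z := (isOpen_paramElement Ξ μ).measurableSet.inter
    (measurableSet_lt (measurable_splineOf Ξ c).abs measurable_const)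
  have hZc : Z ⊆ paramCube d := Set.inter_subset_left.trans hQc
  have hZv : volume.real Z ≤ h ^ d * δ := by
    refine ENNReal.toReal_le_of_le_ofReal (by positivity) ?_
    rw [ENNReal.ofReal_mul (by positivity)]
    refine (measure_mono ?_).trans (hstab (fun l => (Ξ l).extKnot) μ h
      (fun l => (Ξ l).monotone_extKnot) hh (fun l => OpenKnotVector.IsSpan.le (hμ l)) (fun l => ?_)
      (fun l => (Ξ l).extKnot_succ_sub_le (by positivity) fun j hj => (hgap l j hj).2) c')
    · rintro x ⟨hxQ, hx⟩
      refine ⟨fun l => ?_, ?_⟩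
      · rw [OpenKnotVector.IsSpan.extKnot_eq (hμ l), OpenKnotVector.IsSpan.extKnot_succ_eq (hμ l)]
        exact Set.Ioo_subset_Ico_self (hxQ l)
      · rw [Set.mem_ofPred_eq, splineOf_eq_sum_fin c hμ (hQc hxQ)
          (paramElement_subset_closedElement Ξ μ hxQ)] at hx
        exact hx
    · rw [OpenKnotVector.IsSpan.extKnot_eq (hμ l), OpenKnotVector.IsSpan.extKnot_succ_eq (hμ l)]
      exact (hμ l).2
  set T := (F '' Q ∩ Ω) \ F '' Z with hT
  have hTm : MeasurableSet T :=
    ((hF.measurableSet_image (isOpen_paramElement Ξ μ).measurableSet hQc).inter hΩ).diff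
      (hF.measurableSet_image hZm hZc)
  have hFQ := hvol Q hQc
  have hFZ := hvol Z hZc
  have hQv : (h / s) ^ d ≤ volume.real Q := by
    refine le_volumeReal_paramElement (by positivity) fun l => ?_
    rw [div_le_iff₀ hs, mul_comm]
    exact (hgap l (μ l) (hμ l)).1
  have hQpos : 0 < volume.real Q := lt_of_lt_of_le (by positivity) hQv
  have hFQpos : 0 < volume.real (F '' Q) := by
    by_contra hneg
    have : volume.real (F '' Q) = 0 := le_antisymm (not_lt.1 hneg) measureReal_nonneg
    rw [this, mul_zero] at hFQ
    linarith [hFQ.2.2]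
  rw [le_div_iff₀ hFQpos] at hgood
  have hTv : c₀ * δ * h ^ d ≤ volume.real T := by
    have h1 : volume.real (F '' Q ∩ Ω) - volume.real (F '' Z) ≤ volume.real T :=
      le_measureReal_sdiff hFZ.1
    have h2 : (h / s) ^ d / c₀ ≤ volume.real (F '' Q) := by
      rw [div_le_iff₀ hc₀, mul_comm]
      exact hQv.trans hFQ.2.2
    have h3 : θ * ((h / s) ^ d / c₀) ≤ volume.real (F '' Q ∩ Ω) :=
      (mul_le_mul_of_nonneg_left h2 hθ.le).trans hgood
    have h4 : volume.real (F '' Z) ≤ c₀ * (h ^ d * δ) :=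
      hFZ.2.1.trans (mul_le_mul_of_nonneg_left hZv hc₀.le)
    have h5 : θ * ((h / s) ^ d / c₀) = 2 * (c₀ * δ * h ^ d) := by
      rw [hδ, div_pow]
      field_simp
    linarith
  have hbound : ∀ x ∈ T, ENNReal.ofReal ((ε * c i) ^ 2) ≤ ‖q x‖ₑ ^ 2 := by
    rintro _ ⟨⟨⟨y, hy, rfl⟩, hyΩ⟩, hyZ⟩
    rw [enorm_sq_eq_ofReal, hq y (hQc hy) hyΩ]
    refine ENNReal.ofReal_le_ofReal (sq_le_sq.2 ?_)
    rw [abs_mul, abs_of_pos hε]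
    have : ¬|splineOf Ξ c y| < ε * ‖c'‖ := fun hlt => hyZ ⟨y, ⟨hy, hlt⟩, rfl⟩
    exact (mul_le_mul_of_nonneg_left (abs_coeff_le_norm hi) hε.le).trans (not_lt.1 this)
  calc ENNReal.ofReal (ε ^ 2 * (c₀ * δ) * h ^ d * c i ^ 2)
      = ENNReal.ofReal ((ε * c i) ^ 2) * ENNReal.ofReal (c₀ * δ * h ^ d) := by
        rw [← ENNReal.ofReal_mul (sq_nonneg _)]
        congr 1
        ring
    _ ≤ ENNReal.ofReal ((ε * c i) ^ 2) * volume T := by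
        gcongr
        exact ENNReal.ofReal_le_of_le_toReal hTv
    _ = ∫⁻ _ in T, ENNReal.ofReal ((ε * c i) ^ 2) := by rw [setLIntegral_const]
    _ ≤ ∫⁻ x in T, ‖q x‖ₑ ^ 2 := setLIntegral_mono' hTm hbound
    _ ≤ ∫⁻ x in F '' Q ∩ Ω, ‖q x‖ₑ ^ 2 := lintegral_mono_set Set.sdiff_subset

theorem exists_setLIntegral_le
    {F : EuclideanSpace ℝ (Fin d) → EuclideanSpace ℝ (Fin d)}
    (hF : IsBiLipschitzOn F (paramCube d)) (k : ℕ) {s : ℝ} (hs : 0 < s) :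
    ∃ κ : ℝ, 0 < κ ∧ ∀ (Ξ : Fin d → OpenKnotVector k) (h : ℝ), 0 < h →
      (∀ l j, (Ξ l).IsSpan j → (Ξ l).knot (j + 1) - (Ξ l).knot j ≤ s * h) →
      ∀ Ω : Set (EuclideanSpace ℝ (Fin d)), MeasurableSet Ω → ∀ (c : (Fin d → ℕ) → ℝ)
        (q : EuclideanSpace ℝ (Fin d) → ℝ),
      (∀ y ∈ paramCube d, F y ∈ Ω → q (F y) = splineOf Ξ c y) → ∀ μ, IsElementIndex Ξ μ →
      ∫⁻ x in F '' halfOpenElement Ξ μ ∩ Ω, ‖q x‖ₑ ^ 2 ≤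
        ∑ i ∈ activeIndices k μ, ENNReal.ofReal (κ * h ^ d * c i ^ 2) := by
  obtain ⟨c₀, hc₀, hvol⟩ := hF.exists_volumeReal_image_le
  -- The factors come from Cauchy–Schwarz over the active indices, the bound on the B-splines, and
  -- the volume of the image of an element.
  refine ⟨(k + 1) ^ d * ((2 ^ k) ^ d) ^ 2 * (c₀ * s ^ d), by positivity,
    fun Ξ h hh hgap Ω hΩ c q hq μ hμ => ?_⟩
  have hQc : halfOpenElement Ξ μ ⊆ paramCube d := Set.inter_subset_right
  have hm : MeasurableSet (F '' halfOpenElement Ξ μ ∩ Ω) :=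
    (hF.measurableSet_image (measurableSet_halfOpenElement Ξ μ) hQc).inter hΩ
  have hv := hvol _ hQc
  have hv' : volume.real (F '' halfOpenElement Ξ μ) ≤ c₀ * (s * h) ^ d :=
    hv.2.1.trans (mul_le_mul_of_nonneg_left
      (volumeReal_halfOpenElement_le (by positivity) fun l => hgap l _ (hμ l)) hc₀.le)
  set M : ℝ := (k + 1) ^ d * ((2 ^ k) ^ d) ^ 2 * ∑ i ∈ activeIndices k μ, c i ^ 2 with hM
  have hM0 : 0 ≤ M := mul_nonneg (by positivity) (Finset.sum_nonneg fun _ _ => sq_nonneg _)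
  have hbound : ∀ x ∈ F '' halfOpenElement Ξ μ ∩ Ω, ‖q x‖ₑ ^ 2 ≤ ENNReal.ofReal M := by
    rintro _ ⟨⟨y, hy, rfl⟩, hyΩ⟩
    rw [enorm_sq_eq_ofReal, hq y (hQc hy) hyΩ, splineOf_eq_sum_activeIndices c hμ (hQc hy)
      (halfOpenElement_subset_closedElement Ξ μ hy)]
    refine ENNReal.ofReal_le_ofReal (sq_sum_le_card_mul_sum_sq.trans ?_)
    rw [hM, mul_assoc, Finset.mul_sum (activeIndices k μ) (fun i => c i ^ 2)]
    refine mul_le_mul (by exact_mod_cast card_activeIndices_le k μ) (Finset.sum_le_sum fun i hi => ?_)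
      (Finset.sum_nonneg fun _ _ => sq_nonneg _) (by positivity)
    rw [mul_pow, mul_comm]
    refine mul_le_mul_of_nonneg_right ?_ (sq_nonneg _)
    rw [← sq_abs]
    exact pow_le_pow_left₀ (abs_nonneg _)
      (abs_tensorBSpline_le Ξ ((mem_activeIndices.1 hi).mem_splineIndices hμ) y) 2
  calc ∫⁻ x in F '' halfOpenElement Ξ μ ∩ Ω, ‖q x‖ₑ ^ 2
      ≤ ∫⁻ _ in F '' halfOpenElement Ξ μ ∩ Ω, ENNReal.ofReal M := setLIntegral_mono' hm hbound
    _ = ENNReal.ofReal M * volume (F '' halfOpenElement Ξ μ ∩ Ω) := setLIntegral_const _ _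
    _ ≤ ENNReal.ofReal M * ENNReal.ofReal (c₀ * (s * h) ^ d) := by
        gcongr
        refine (measure_mono Set.inter_subset_left).trans ?_
        rw [← ENNReal.ofReal_toReal hv.1]
        exact ENNReal.ofReal_le_ofReal hv'
    _ = _ := by
        rw [← ENNReal.ofReal_mul hM0, ← ENNReal.ofReal_sum_of_nonneg fun i _ => by positivity,
          ← Finset.mul_sum, hM, mul_pow]
        congr 1
        ring

/-! ### Good elements and the bad region. -/

section
variable {F : EuclideanSpace ℝ (Fin d) → EuclideanSpace ℝ (Fin d)} {Ξ : Fin d → OpenKnotVector k}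
  {Ω : Set (EuclideanSpace ℝ (Fin d))} {θ : ℝ}

/-- If bad points converged to a point of a good element, their preimages would converge in the cube
and eventually enter the open parametric element, making them points of the good element. -/
theorem inter_subset_diff_closure_badRegion (hF : IsBiLipschitzOn F (paramCube d))
    (hΩ : Ω ⊆ F '' paramCube d) {ν : Fin d → ℕ} (hν : IsElementIndex Ξ ν)
    (hgood : F '' paramElement Ξ ν ∈ goodElements F Ξ Ω θ) :
    F '' paramElement Ξ ν ∩ Ω ⊆ Ω \ closure (badRegion F Ξ Ω θ) := by
  rintro _ ⟨⟨y, hy, rfl⟩, hyΩ⟩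
  refine ⟨hyΩ, fun hcl => ?_⟩
  obtain ⟨x, hxS, hx⟩ := mem_closure_iff_seq_limit.1 hcl
  choose u hu hux using fun n => hΩ (hxS n).1
  obtain rfl : (fun n => F (u n)) = x := funext hux
  have hlim := hF.tendsto_of_tendsto_image hu (paramElement_subset_paramCube hν hy) hx
  obtain ⟨n, hn⟩ := (hlim.eventually ((isOpen_paramElement Ξ ν).mem_nhds hy)).exists
  exact (hxS n).2 (Set.mem_biUnion hgood (subset_closure ⟨u n, hn, rfl⟩))

theorem exists_good_of_notMem_badRegion (hF : IsBiLipschitzOn F (paramCube d))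
    {y : EuclideanSpace ℝ (Fin d)} (hy : y ∈ paramCube d) (hyΩ : F y ∈ Ω)
    (h : F y ∉ badRegion F Ξ Ω θ) : ∃ ν, IsElementIndex Ξ ν ∧
      F '' paramElement Ξ ν ∈ goodElements F Ξ Ω θ ∧ y ∈ closedElement Ξ ν := by
  have h' : F y ∈ ⋃ K ∈ goodElements F Ξ Ω θ, closure K := by
    by_contra hn
    exact h ⟨hyΩ, hn⟩
  obtain ⟨K, hK, hyK⟩ := Set.mem_iUnion₂.1 h'
  obtain ⟨⟨Q, ⟨ν, hν, rfl⟩, -, rfl⟩, -⟩ := id hK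
  refine ⟨ν, hν, hK, closure_paramElement_subset Ξ ν ?_⟩
  obtain ⟨x, hxK, hx⟩ := mem_closure_iff_seq_limit.1 hyK
  choose u hu hux using hxK
  obtain rfl : (fun n => F (u n)) = x := funext hux
  exact mem_closure_of_tendsto
    (hF.tendsto_of_tendsto_image (fun n => paramElement_subset_paramCube hν (hu n)) hy hx)
    (Filter.Eventually.of_forall hu)

theorem sum_setLIntegral_good_le (hF : IsBiLipschitzOn F (paramCube d))
    (hΩ : Ω ⊆ F '' paramCube d) (hΩm : MeasurableSet Ω) (f : EuclideanSpace ℝ (Fin d) → ENNReal)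
    (G : Finset (Fin d → ℕ)) (hG : ∀ ν ∈ G, IsElementIndex Ξ ν ∧
      F '' paramElement Ξ ν ∈ goodElements F Ξ Ω θ) :
    ∑ ν ∈ G, ∫⁻ x in F '' paramElement Ξ ν ∩ Ω, f x
      ≤ ∫⁻ x in Ω \ closure (badRegion F Ξ Ω θ), f x := by
  rw [← lintegral_biUnion_finset]
  · exact lintegral_mono_set (Set.iUnion₂_subset fun ν hν =>
      inter_subset_diff_closure_badRegion hF hΩ (hG ν hν).1 (hG ν hν).2)
  · intro μ hμ ν hν hne
    rw [Function.onFun, Set.disjoint_left]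
    rintro _ ⟨⟨y, hy, rfl⟩, -⟩ ⟨⟨z, hz, hzy⟩, -⟩
    have hμ' := (hG μ hμ).1
    have hν' := (hG ν hν).1
    have := hF.injOn (paramElement_subset_paramCube hν' hz) (paramElement_subset_paramCube hμ' hy) hzy
    subst this
    exact hne (hμ'.eq_of_mem hν' hy hz)
  · intro ν hν
    exact (hF.measurableSet_image (isOpen_paramElement Ξ ν).measurableSet
      (paramElement_subset_paramCube (hG ν hν).1)).inter hΩm

end

/-! ### Summation over the mesh. -/

/-- The indices of the elements of the parametric mesh. -/
def elementIndices (Ξ : Fin d → OpenKnotVector k) : Finset (Fin d → ℕ) := by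
  classical
  exact (Fintype.piFinset fun l => Finset.range ((Ξ l).n + k)).filter (IsElementIndex Ξ)

theorem mem_elementIndices {Ξ : Fin d → OpenKnotVector k} {μ : Fin d → ℕ} :
    μ ∈ elementIndices Ξ ↔ IsElementIndex Ξ μ := by
  simp only [elementIndices, Finset.mem_filter, Fintype.mem_piFinset, Finset.mem_range,
    and_iff_right_iff_imp]
  exact fun h l => (h l).1

theorem card_filter_isActive_le (k : ℕ) (i : Fin d → ℕ) (E : Finset (Fin d → ℕ))
    [DecidablePred fun μ => IsActive k i μ] :
    (E.filter fun μ => IsActive k i μ).card ≤ (k + 1) ^ d := by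
  refine (Finset.card_le_card (t := Fintype.piFinset fun l => Finset.Icc (i l) (i l + k)) ?_).trans ?_
  · intro μ hμ
    simp only [Fintype.mem_piFinset, Finset.mem_Icc]
    exact (Finset.mem_filter.1 hμ).2
  · rw [Fintype.card_piFinset]
    refine (Finset.prod_le_prod' (g := fun _ => k + 1) fun l _ => ?_).trans_eq (by simp)
    rw [Nat.card_Icc]
    omega

/-- The double counting behind the summation of the local estimates: every element has at most
`(k + 1) ^ d` active indices, every index is active on at most `(k + 1) ^ d` elements, and the
contribution of an index is controlled by that of one good element on which it is active. -/
theorem sum_sum_activeIndices_le (k : ℕ) (E G : Finset (Fin d → ℕ)) (a J : (Fin d → ℕ) → ENNReal)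
    (h : ∀ i, a i ≠ 0 → ∃ ν ∈ G, IsActive k i ν ∧ a i ≤ J ν) :
    ∑ μ ∈ E, ∑ i ∈ activeIndices k μ, a i ≤ ((k + 1) ^ d * (k + 1) ^ d : ℕ) * ∑ ν ∈ G, J ν := by
  classical
  have h1 : ∀ i, a i ≤ ∑ ν ∈ G, if IsActive k i ν then J ν else 0 := by
    intro i
    by_cases hi : a i = 0
    · simp [hi]
    obtain ⟨ν, hν, hact, hle⟩ := h i hi
    refine hle.trans ?_
    have := Finset.single_le_sum (f := fun ν => if IsActive k i ν then J ν else 0)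
      (fun _ _ => zero_le) hν
    simpa [hact] using this
  set I : Finset (Fin d → ℕ) := E.biUnion (activeIndices k) with hI
  calc ∑ μ ∈ E, ∑ i ∈ activeIndices k μ, a i
      = ∑ μ ∈ E, ∑ i ∈ I, if IsActive k i μ then a i else 0 := by
        refine Finset.sum_congr rfl fun μ hμ => ?_
        rw [← Finset.sum_filter]
        refine Finset.sum_congr ?_ fun _ _ => rfl
        ext i
        simp only [Finset.mem_filter, ← mem_activeIndices, hI, Finset.mem_biUnion]
        exact ⟨fun hi => ⟨⟨μ, hμ, hi⟩, hi⟩, fun hi => hi.2⟩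
    _ = ∑ i ∈ I, ((E.filter fun μ => IsActive k i μ).card : ENNReal) * a i := by
        rw [Finset.sum_comm]
        refine Finset.sum_congr rfl fun i _ => ?_
        rw [← Finset.sum_filter, Finset.sum_const, nsmul_eq_mul]
    _ ≤ ∑ i ∈ I, ((k + 1) ^ d : ℕ) * ∑ ν ∈ G, if IsActive k i ν then J ν else 0 := by
        refine Finset.sum_le_sum fun i _ => mul_le_mul' ?_ (h1 i)
        exact_mod_cast card_filter_isActive_le k i E
    _ = ((k + 1) ^ d : ℕ) * ∑ ν ∈ G, ((I.filter fun i => IsActive k i ν).card : ENNReal) * J ν := by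
        rw [← Finset.mul_sum, Finset.sum_comm]
        congr 1
        refine Finset.sum_congr rfl fun ν _ => ?_
        rw [← Finset.sum_filter, Finset.sum_const, nsmul_eq_mul]
    _ ≤ ((k + 1) ^ d : ℕ) * ∑ ν ∈ G, (((k + 1) ^ d : ℕ) : ENNReal) * J ν := by
        refine mul_le_mul_right (Finset.sum_le_sum fun ν _ => mul_le_mul_left ?_ _) _
        refine Nat.cast_le.2 ((Finset.card_le_card fun i hi => ?_).trans
          (card_activeIndices_le k ν))
        exact mem_activeIndices.2 (Finset.mem_filter.1 hi).2
    _ = _ := by rw [← Finset.mul_sum, ← mul_assoc, Nat.cast_mul]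

theorem lintegral_biUnion_finset_le {α β : Type*} [MeasurableSpace α] {μ : Measure α}
    (E : Finset β) (s : β → Set α) (f : α → ENNReal) :
    ∫⁻ x in ⋃ b ∈ E, s b, f x ∂μ ≤ ∑ b ∈ E, ∫⁻ x in s b, f x ∂μ := by
  have e : ⋃ b ∈ E, s b = ⋃ b : E, s b := by
    ext x
    simp
  rw [e]
  refine (lintegral_iUnion_le _ f).trans_eq ?_
  rw [tsum_fintype]
  exact Finset.sum_coe_sort E fun b => ∫⁻ x in s b, f x ∂μ

theorem eLpNorm_two_le_of_lintegral_le {α : Type*} [MeasurableSpace α] {f g : α → ℝ}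
    {μ ν : Measure α} {K : ℝ} (hK : 0 ≤ K)
    (h : ∫⁻ x, ‖f x‖ₑ ^ 2 ∂μ ≤ ENNReal.ofReal K * ∫⁻ x, ‖g x‖ₑ ^ 2 ∂ν) :
    eLpNorm f 2 μ ≤ ENNReal.ofReal (√K) * eLpNorm g 2 ν := by
  have e : ∀ (f : α → ℝ) (μ : Measure α), eLpNorm f 2 μ = (∫⁻ x, ‖f x‖ₑ ^ 2 ∂μ) ^ (1 / 2 : ℝ) := by
    intro f μ
    rw [eLpNorm_eq_lintegral_rpow_enorm_toReal (by norm_num) (by norm_num)]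
    simp
  rw [e, e, Real.sqrt_eq_rpow, ← ENNReal.ofReal_rpow_of_nonneg hK (by norm_num),
    ← ENNReal.mul_rpow_of_nonneg _ _ (by norm_num)]
  exact ENNReal.rpow_le_rpow h (by norm_num)

end

/-! ### The truncated spline and its stability. -/

theorem mainTheorem9 (d : ℕ) (hd : d = 2 ∨ d = 3) (k : ℕ) (hk : 1 ≤ k)
    (F : EuclideanSpace ℝ (Fin d) → EuclideanSpace ℝ (Fin d))
    (hF : IsBiLipschitzOn F (paramCube d))
    (θ : ℝ) (hθ : 0 < θ) (hθ' : θ ≤ 1) (σ : ℝ) :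
    ∃ C : ℝ, 0 < C ∧
      ∀ Ξ : Fin d → OpenKnotVector k, IsShapeRegular σ Ξ →
      ∀ Ω₁ Ω : Set (EuclideanSpace ℝ (Fin d)), Ω = trimmedDomain F Ω₁ →
      ∀ q ∈ pressureSpace F Ξ Ω, ∃ q' ∈ pressureSpace F Ξ Ω,
        Set.EqOn q' q (Ω \ closure (badRegion F Ξ Ω θ)) ∧
        eLpNorm q' 2 (volume.restrict Ω) ≤
          ENNReal.ofReal C *
            eLpNorm q 2 (volume.restrict (Ω \ closure (badRegion F Ξ Ω θ))) := by
  classical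
  set s : ℝ := max σ 1 ^ 2 with hs
  have hs0 : 0 < s := by positivity
  obtain ⟨κ, hκ, hlower⟩ := exists_le_setLIntegral_of_good hF k hθ hs0
  obtain ⟨κ', hκ', hupper⟩ := exists_setLIntegral_le hF k hs0
  set N : ℕ := (k + 1) ^ d * (k + 1) ^ d with hN
  set K : ℝ := N * (κ' / κ) with hK
  have hK0 : 0 < K := by positivity
  refine ⟨√K, Real.sqrt_pos.2 hK0, fun Ξ hΞ Ω₁ Ω hΩ q hq => ?_⟩
  obtain ⟨h, hh, hgap⟩ := hΞ.exists_meshSize (by omega)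
  obtain ⟨q₀, ⟨sp, hsp, hq₀⟩, hqq₀⟩ := hq
  obtain ⟨c, rfl⟩ := exists_eq_splineOf hsp
  have hΩF : Ω ⊆ F '' paramCube d := hΩ ▸ Set.sdiff_subset
  have hΩm : MeasurableSet Ω := by
    rw [hΩ]
    exact (hF.measurableSet_image (isOpen_paramCube d).measurableSet subset_rfl).diff
      isClosed_closure.measurableSet
  have hqF : ∀ y ∈ paramCube d, F y ∈ Ω → q (F y) = splineOf Ξ c y := fun y hy hyΩ =>
    (hqq₀ hyΩ).trans (hq₀ hy)
  set G : Finset (Fin d → ℕ) := (elementIndices Ξ).filter fun ν =>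
    F '' paramElement Ξ ν ∈ goodElements F Ξ Ω θ with hG
  have hGmem : ∀ ν ∈ G, IsElementIndex Ξ ν ∧ F '' paramElement Ξ ν ∈ goodElements F Ξ Ω θ :=
    fun ν hν => ⟨mem_elementIndices.1 (Finset.mem_filter.1 hν).1, (Finset.mem_filter.1 hν).2⟩
  -- Dropping the B-splines active on no good element discards exactly the coefficients that the
  -- good elements cannot control.
  set c' : (Fin d → ℕ) → ℝ := fun i => if ∃ ν ∈ G, IsActive k i ν then c i else 0 with hc'
  set q' : EuclideanSpace ℝ (Fin d) → ℝ := fun x =>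
    splineOf Ξ c' (Function.invFunOn F (paramCube d) x) with hq'
  have hq'F : ∀ y ∈ paramCube d, q' (F y) = splineOf Ξ c' y := fun y hy => by
    simp only [hq', hF.injOn.leftInvOn_invFunOn hy]
  refine ⟨q', ⟨q', ⟨splineOf Ξ c', splineOf_mem Ξ c', fun y hy => hq'F y hy⟩, fun _ _ => rfl⟩,
    ?_, ?_⟩
  · rintro x ⟨hxΩ, hxS⟩
    obtain ⟨y, hy, rfl⟩ := hΩF hxΩ
    obtain ⟨ν, hν, hgood, hyν⟩ := exists_good_of_notMem_badRegion hF hy hxΩ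
      fun hx => hxS (subset_closure hx)
    rw [hq'F y hy, hqF y hy hxΩ]
    refine splineOf_congr hν (fun i hi => ?_) hy hyν
    exact if_pos ⟨ν, Finset.mem_filter.2 ⟨mem_elementIndices.2 hν, hgood⟩, hi⟩
  · refine eLpNorm_two_le_of_lintegral_le hK0.le ?_
    -- Half-open boxes cover every point, so element boundaries need no null-set argument.
    have hcover : Ω ⊆ ⋃ μ ∈ elementIndices Ξ, F '' halfOpenElement Ξ μ ∩ Ω := by
      intro x hx
      obtain ⟨y, hy, rfl⟩ := hΩF hx
      obtain ⟨μ, hμ, hyμ⟩ := exists_mem_halfOpenElement Ξ hy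
      exact Set.mem_biUnion (Finset.mem_coe.2 (mem_elementIndices.2 hμ)) ⟨⟨y, hyμ, rfl⟩, hx⟩
    set T := ∫⁻ x in Ω \ closure (badRegion F Ξ Ω θ), ‖q x‖ₑ ^ 2 with hT
    have hcount := sum_sum_activeIndices_le k (elementIndices Ξ) G
      (fun i => ENNReal.ofReal (κ' * h ^ d * c' i ^ 2))
      (fun ν => ENNReal.ofReal (κ' / κ) * ∫⁻ x in F '' paramElement Ξ ν ∩ Ω, ‖q x‖ₑ ^ 2) (by
        intro i hi
        by_cases hex : ∃ ν ∈ G, IsActive k i ν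
        · obtain ⟨ν, hν, hact⟩ := id hex
          refine ⟨ν, hν, hact, ?_⟩
          have hl := hlower Ξ h hh hgap Ω hΩm c q hqF ν (hGmem ν hν).1 (hGmem ν hν).2.2 i hact
          simp only [hc', if_pos hex]
          refine le_trans (le_of_eq ?_) (mul_le_mul_right hl _)
          rw [← ENNReal.ofReal_mul (by positivity)]
          congr 1
          field_simp
        · simp [hc', if_neg hex] at hi)
    calc ∫⁻ x in Ω, ‖q' x‖ₑ ^ 2
        ≤ ∫⁻ x in ⋃ μ ∈ elementIndices Ξ, F '' halfOpenElement Ξ μ ∩ Ω, ‖q' x‖ₑ ^ 2 :=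
          lintegral_mono_set hcover
      _ ≤ ∑ μ ∈ elementIndices Ξ, ∫⁻ x in F '' halfOpenElement Ξ μ ∩ Ω, ‖q' x‖ₑ ^ 2 :=
          lintegral_biUnion_finset_le _ _ _
      _ ≤ ∑ μ ∈ elementIndices Ξ, ∑ i ∈ activeIndices k μ,
            ENNReal.ofReal (κ' * h ^ d * c' i ^ 2) :=
          -- The upper estimate holds on all elements, good or bad, since it needs no lower bound on
          -- the volume kept.
          Finset.sum_le_sum fun μ hμ => hupper Ξ h hh (fun l j hj => (hgap l j hj).2) Ω hΩm c' q'
            (fun y hy _ => hq'F y hy) μ (mem_elementIndices.1 hμ)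
      _ ≤ (N : ENNReal) * ∑ ν ∈ G, ENNReal.ofReal (κ' / κ) *
            ∫⁻ x in F '' paramElement Ξ ν ∩ Ω, ‖q x‖ₑ ^ 2 := hcount
      _ ≤ (N : ENNReal) * (ENNReal.ofReal (κ' / κ) * T) := by
          rw [← Finset.mul_sum]
          gcongr
          exact sum_setLIntegral_good_le hF hΩF hΩm _ G hGmem
      _ = ENNReal.ofReal K * T := by
          rw [hK, ENNReal.ofReal_mul (Nat.cast_nonneg _), ENNReal.ofReal_natCast, mul_assoc]
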